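/- All vector spaces are over $\mathbf{C}$, of arbitrary dimension. Let $\mathrm{Vec}^\Delta$ be the category whose objects are pairs $(V,L)$, where $L$ is a nonempty finite set and $V=(V_x)_{x\in L}$ is a family of vector spaces; a morphism $(V,L)\to(V',L')$ is a surjection $\sigma:L'\to L$ together with linear maps $V_x\to\bigotimes_{\sigma(y)=x}V'_y$ for all $x\in L$. A functor of $L$-indexed families of vector spaces is *nice* if it is a (possibly infinite) direct sum of subquotients of functors $(V_x)_x\mapsto\bigotimes_x V_x^{\otimes n_x}$ with integers $n_x\ge 0$. A *$\Delta$-module* is a functor $F:\mathrm{Vec}^\Delta\to\mathrm{Vec}$ whose restriction to $L$-indexed families (with $L$ fixed) is nice for every $L$. For $n\ge 0$ let $\Phi(T_n)$ be the $\Delta$-module $(V,L)\mapsto\bigotimes_{x\in L}V_x^{\otimes n}=\bigl(\bigotimes_{x\in L}V_x\bigr)^{\otimes n}$; in particular $\Phi(T_0)$ is the constant functor $\mathbf{C}$. A $\Delta$-module is *small* if it is a subquotient of a finite direct sum of $\Delta$-modules $\Phi(T_n)$ with $n\ge 1$ (where $n$ may vary). Let $P(V,L)=\mathrm{Sym}\bigl(\bigotimes_{x\in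 L}V_x\bigr)$ and $\mathbf{V}(V,L)=\mathrm{Spec}\,P(V,L)$, the space $\bigotimes_{x\in L}V_x^*$ regarded as a scheme; it is contravariantly functorial in $(V,L)$. A *$\Delta$-scheme* is a contravariant functor $X$ from $\mathrm{Vec}^\Delta$ to schemes, with $X(V,L)\neq\emptyset$ for all $(V,L)$, together with a natural closed immersion $X\to\mathbf{V}$. Let $R(V,L)$ be the affine coordinate ring of $X(V,L)$, a quotient of $P(V,L)$, and put $$F_p(V,L)=\mathrm{Tor}_p^{P(V,L)}(R(V,L),\mathbf{C}),$$ where $\mathbf{C}$ is the quotient of $P(V,L)$ by the ideal generated by $\bigotimes_x V_x$; with the change-of-rings maps of $\mathrm{Tor}$, $F_p$ is a functor $\mathrm{Vec}^\Delta\to\mathrm{Vec}$. Let $F_p^{(d)}$ be its degree $d$ piece for the grading coming from those of $P$ and $R$; equivalently, the part on which, for all $x\in L$ and $t\in\mathbf{C}$, the endomorphism of $(V,L)$ that multiplies $V_x$ by $t$ acts as $t^d$. **Theorem.** Let $X$ be a $\Delta$-scheme and let $p,d\ge 0$ be integers. Then $F_p^{(d)}$ is a $\Delta$-module. If $(p,d)\neq(0,0)$,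 it is small. If $(p,d)=(0,0)$, it is isomorphic to the constant functor $\Phi(T_0)=\mathbf{C}$. -/

import Mathlib

open CategoryTheory Limits AlgebraicGeometry
open scoped TensorProduct

universe u v w

noncomputable section

namespace DeltaSyz

section Nest

variable {Y Z : Type u} {C : Y → Type u}

open Classical in
/-- The canonical map `⨂_z M_z → ⨂_y ⨂_{c ∈ C_y} M_z` regrouping the factors of a tensor product
along a decomposition `Z = ∐_y C_y`. -/
def nest (e : (Σ y, C y) ≃ Z) (M : Z → Type u) [∀ z, AddCommMonoid (M z)] [∀ z, Module ℂ (M z)] :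
    (⨂[ℂ] z, M z) →ₗ[ℂ] ⨂[ℂ] y, ⨂[ℂ] c : C y, M (e ⟨y, c⟩) :=
  PiTensorProduct.lift
    { toFun := fun m => PiTensorProduct.tprod ℂ fun y => PiTensorProduct.tprod ℂ fun c => m (e ⟨y, c⟩)
      map_update_add' := by
        intro inst m z a b
        obtain ⟨⟨y₀, c₀⟩, rfl⟩ := e.surjective z
        have key : ∀ t : M (e ⟨y₀, c₀⟩), (fun y => PiTensorProduct.tprod ℂ fun c =>
            (Function.update m (e ⟨y₀, c₀⟩) t) (e ⟨y, c⟩)) =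
            Function.update (fun y => PiTensorProduct.tprod ℂ fun c => m (e ⟨y, c⟩)) y₀
              (PiTensorProduct.tprod ℂ (Function.update (fun c => m (e ⟨y₀, c⟩)) c₀ t)) := by
          intro t
          funext y
          by_cases hy : y = y₀
          · subst hy
            simp only [Function.update_self]
            congr 1
            funext c
            by_cases hc : c = c₀
            · subst hc; simp
            · rw [Function.update_of_ne hc, Function.update_of_ne]
              simpa using hc
          · rw [Function.update_of_ne hy]
            congr 1
            funext c
            rw [Function.update_of_ne]
            intro h
            exact hy (congrArg Sigma.fst (e.injective h))
        rw [Subsingleton.elim inst (Classical.decEq _)] at *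
        rw [key, key, key, MultilinearMap.map_update_add, MultilinearMap.map_update_add]
      map_update_smul' := by
        intro inst m z r a
        obtain ⟨⟨y₀, c₀⟩, rfl⟩ := e.surjective z
        have key : ∀ t : M (e ⟨y₀, c₀⟩), (fun y => PiTensorProduct.tprod ℂ fun c =>
            (Function.update m (e ⟨y₀, c₀⟩) t) (e ⟨y, c⟩)) =
            Function.update (fun y => PiTensorProduct.tprod ℂ fun c => m (e ⟨y, c⟩)) y₀
              (PiTensorProduct.tprod ℂ (Function.update (fun c => m (e ⟨y₀, c⟩)) c₀ t)) := by
          intro t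
          funext y
          by_cases hy : y = y₀
          · subst hy
            simp only [Function.update_self]
            congr 1
            funext c
            by_cases hc : c = c₀
            · subst hc; simp
            · rw [Function.update_of_ne hc, Function.update_of_ne]
              simpa using hc
          · rw [Function.update_of_ne hy]
            congr 1
            funext c
            rw [Function.update_of_ne]
            intro h
            exact hy (congrArg Sigma.fst (e.injective h))
        rw [Subsingleton.elim inst (Classical.decEq _)] at *
        rw [key, key, MultilinearMap.map_update_smul, MultilinearMap.map_update_smul] }

variable (e : (Σ y, C y) ≃ Z) (M : Z → Type u) [∀ z, AddCommMonoid (M z)] [∀ z, Module ℂ (M z)]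

theorem nest_tprod (m : ∀ z, M z) :
    nest e M (PiTensorProduct.tprod ℂ m) =
      PiTensorProduct.tprod ℂ fun y => PiTensorProduct.tprod ℂ fun c => m (e ⟨y, c⟩) := by
  simp [nest]

theorem nest_bijective [Finite Y] [Finite Z] : Function.Bijective (nest e M) := by
  have hfin : ∀ y, Finite (C y) := fun y =>
    Finite.of_injective (fun c => e ⟨y, c⟩) fun a b h => by simpa using h
  let _ : ∀ z, AddCommGroup (M z) := fun z => Module.addCommMonoidToAddCommGroup ℂ
  let b := fun z => Module.Basis.ofVectorSpace ℂ (M z)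
  let E := (Equiv.piCongrLeft (fun z => Module.Basis.ofVectorSpaceIndex ℂ (M z)) e).symm.trans
    (Equiv.piCurry (fun y c => Module.Basis.ofVectorSpaceIndex ℂ (M (e ⟨y, c⟩))))
  let L := (Basis.piTensorProduct b).equiv
    (Basis.piTensorProduct fun y => Basis.piTensorProduct fun c : C y => b (e ⟨y, c⟩)) E
  have hL : nest e M = L.toLinearMap := by
    refine (Basis.piTensorProduct b).ext fun p => ?_
    rw [LinearEquiv.coe_coe, Module.Basis.equiv_apply, Basis.piTensorProduct_apply,
      Basis.piTensorProduct_apply, nest_tprod]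
    simp only [Basis.piTensorProduct_apply]
    rfl
  rw [hL]
  exact L.bijective

/-- The inverse regrouping isomorphism `⨂_y ⨂_{c ∈ C_y} M_z ≅ ⨂_z M_z`. -/
def flatten [Finite Y] [Finite Z] :
    (⨂[ℂ] y, ⨂[ℂ] c : C y, M (e ⟨y, c⟩)) ≃ₗ[ℂ] ⨂[ℂ] z, M z :=
  (LinearEquiv.ofBijective (nest e M) (nest_bijective e M)).symm

theorem flatten_nest [Finite Y] [Finite Z] (t : ⨂[ℂ] z, M z) : flatten e M (nest e M t) = t :=
  (LinearEquiv.ofBijective (nest e M) (nest_bijective e M)).symm_apply_apply t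

theorem flatten_tprod [Finite Y] [Finite Z] (m : ∀ z, M z) :
    flatten e M (PiTensorProduct.tprod ℂ fun y => PiTensorProduct.tprod ℂ fun c => m (e ⟨y, c⟩)) =
      PiTensorProduct.tprod ℂ m := by
  rw [← nest_tprod, flatten_nest]

/-- Two linear maps out of an iterated tensor product agree if they agree on iterated pure
tensors. -/
theorem nested_ext [Finite Y] [Finite Z] {N : Type*} [AddCommMonoid N] [Module ℂ N]
    {f g : (⨂[ℂ] y, ⨂[ℂ] c : C y, M (e ⟨y, c⟩)) →ₗ[ℂ] N}
    (h : ∀ m : ∀ z, M z,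
      f (PiTensorProduct.tprod ℂ fun y => PiTensorProduct.tprod ℂ fun c => m (e ⟨y, c⟩)) =
      g (PiTensorProduct.tprod ℂ fun y => PiTensorProduct.tprod ℂ fun c => m (e ⟨y, c⟩))) :
    f = g := by
  have : f ∘ₗ nest e M = g ∘ₗ nest e M := by
    ext m
    simpa [nest_tprod] using h m
  ext1
  ext t
  obtain ⟨s, hs⟩ := (nest_bijective e M).2 (PiTensorProduct.tprod ℂ t)
  have := LinearMap.congr_fun this s
  simp only [LinearMap.comp_apply, hs] at this
  exact this

end Nest

/-- Objects `(V, L)`: a nonempty finite set `L` together with a complex vector space `V_x`, of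
arbitrary dimension, for every `x ∈ L`. -/
structure VecDelta : Type (u + 1) where
  L : Type u
  [finite : Finite L]
  [nonempty : Nonempty L]
  V : L → ModuleCat.{u} ℂ

attribute [instance] VecDelta.finite VecDelta.nonempty

namespace VecDelta

/-- A morphism `(V, L) ⟶ (V', L')`: a surjection `σ : L' → L` and for every `x ∈ L` a linear map
`V_x → ⨂_{σ y = x} V'_y`. -/
structure Hom (A B : VecDelta.{u}) : Type u where
  σ : B.L → A.L
  surj : Function.Surjective σ
  lin : ∀ x : A.L, A.V x →ₗ[ℂ] ⨂[ℂ] y : {y : B.L // σ y = x}, B.V y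

/-- For `K → J → I` the fibre over `x ∈ I` decomposes into the fibres over the `y ∈ J` above `x`. -/
abbrev fibreEquiv {I J K : Type u} (σ : J → I) (τ : K → J) (x : I) :
    (Σ y : {y : J // σ y = x}, {z : K // τ z = y.1}) ≃ {z : K // σ (τ z) = x} where
  toFun p := ⟨p.2.1, by rw [p.2.2, p.1.2]⟩
  invFun z := ⟨⟨τ z.1, z.2⟩, ⟨z.1, rfl⟩⟩
  left_inv := by rintro ⟨⟨y, hy⟩, ⟨z, hz⟩⟩; cases hz; rfl
  right_inv _ := rfl

/-- `J` is the disjoint union of the fibres of `σ : J → I`. -/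
abbrev totalEquiv {I J : Type u} (σ : J → I) : (Σ x : I, {y : J // σ y = x}) ≃ J where
  toFun p := p.2.1
  invFun y := ⟨σ y, ⟨y, rfl⟩⟩
  left_inv := by rintro ⟨x, ⟨y, rfl⟩⟩; rfl
  right_inv _ := rfl

/-- The identity morphism. -/
def Hom.id (A : VecDelta.{u}) : Hom A A where
  σ := fun x => x
  surj := Function.surjective_id
  lin x := (PiTensorProduct.subsingletonEquiv (R := ℂ)
    (s := fun y : {y : A.L // y = x} => A.V y) ⟨x, rfl⟩).symm.toLinearMap

/-- Composition: apply `f_x : V_x → ⨂_y V'_y`, then the tensor product over the `y` above `x` of the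
maps `g_y : V'_y → ⨂_z V''_z`, and regroup the factors. -/
def Hom.comp {A B D : VecDelta.{u}} (f : Hom A B) (g : Hom B D) : Hom A D where
  σ := fun z => f.σ (g.σ z)
  surj := f.surj.comp g.surj
  lin x := (flatten (fibreEquiv f.σ g.σ x) (fun z => D.V z.1)).toLinearMap ∘ₗ
    PiTensorProduct.map (fun y : {y // f.σ y = x} => g.lin y.1) ∘ₗ f.lin x

theorem map_subsingletonEquiv_symm {ι : Type*} [Subsingleton ι] (i : ι) {s t : ι → Type*}
    [∀ i, AddCommMonoid (s i)] [∀ i, Module ℂ (s i)] [∀ i, AddCommMonoid (t i)]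
    [∀ i, Module ℂ (t i)] (f : ∀ i, s i →ₗ[ℂ] t i) (v : s i) :
    PiTensorProduct.map f ((PiTensorProduct.subsingletonEquiv (R := ℂ) i).symm v) =
      (PiTensorProduct.subsingletonEquiv (R := ℂ) i).symm (f i v) := by
  classical
  rw [LinearEquiv.eq_symm_apply, PiTensorProduct.subsingletonEquiv_symm_apply,
    PiTensorProduct.map_tprod, PiTensorProduct.subsingletonEquiv_apply_tprod]
  simp

theorem flatten_subsingletonEquiv_symm {I J : Type u} [Finite I] [Finite J] (σ : J → I) (x : I)
    (U : J → Type u) [∀ y, AddCommMonoid (U y)] [∀ y, Module ℂ (U y)]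
    (t : ⨂[ℂ] y : {y : J // σ y = x}, U y.1) :
    flatten (fibreEquiv (fun x : I => x) σ x) (fun z => U z.1)
      ((PiTensorProduct.subsingletonEquiv (R := ℂ)
        (s := fun x' : {x' : I // x' = x} => ⨂[ℂ] y : {y : J // σ y = x'.1}, U y.1)
          ⟨x, rfl⟩).symm t) = t := by
  have : (flatten (fibreEquiv (fun x : I => x) σ x) (fun z => U z.1)).toLinearMap ∘ₗ
      (PiTensorProduct.subsingletonEquiv (R := ℂ)
        (s := fun x' : {x' : I // x' = x} => ⨂[ℂ] y : {y : J // σ y = x'.1}, U y.1)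
          ⟨x, rfl⟩).symm.toLinearMap = LinearMap.id := by
    ext m
    have h : (PiTensorProduct.subsingletonEquiv (R := ℂ)
        (s := fun x' : {x' : I // x' = x} => ⨂[ℂ] y : {y : J // σ y = x'.1}, U y.1)
          ⟨x, rfl⟩).symm (PiTensorProduct.tprod ℂ m) =
        PiTensorProduct.tprod ℂ fun y => PiTensorProduct.tprod ℂ fun c =>
          m (fibreEquiv (fun x : I => x) σ x ⟨y, c⟩) := by
      rw [LinearEquiv.symm_apply_eq, PiTensorProduct.subsingletonEquiv_apply_tprod]
      rfl
    simp only [LinearMap.compMultilinearMap_apply, LinearMap.comp_apply, LinearEquiv.coe_coe, h,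
      LinearMap.id_apply]
    exact flatten_tprod (fibreEquiv (fun x : I => x) σ x) (fun z => U z.1) m
  exact LinearMap.congr_fun this t

theorem Hom.id_comp_aux {A B : VecDelta.{u}} (σ : B.L → A.L) (x : A.L)
    (t : ⨂[ℂ] y : {y : B.L // σ y = x}, B.V y) :
    flatten (fibreEquiv (fun x : A.L => x) σ x) (fun z => B.V z.1)
      ((PiTensorProduct.subsingletonEquiv (R := ℂ)
        (s := fun x' : {x' : A.L // x' = x} => ⨂[ℂ] y : {y : B.L // σ y = x'.1}, B.V y)
          ⟨x, rfl⟩).symm t) = t := by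
  have : (flatten (fibreEquiv (fun x : A.L => x) σ x) (fun z => B.V z.1)).toLinearMap ∘ₗ
      (PiTensorProduct.subsingletonEquiv (R := ℂ)
        (s := fun x' : {x' : A.L // x' = x} => ⨂[ℂ] y : {y : B.L // σ y = x'.1}, B.V y)
          ⟨x, rfl⟩).symm.toLinearMap = LinearMap.id := by
    ext m
    have h : (PiTensorProduct.subsingletonEquiv (R := ℂ)
        (s := fun x' : {x' : A.L // x' = x} => ⨂[ℂ] y : {y : B.L // σ y = x'.1}, B.V y)
          ⟨x, rfl⟩).symm (PiTensorProduct.tprod ℂ m) =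
        PiTensorProduct.tprod ℂ fun y => PiTensorProduct.tprod ℂ fun c =>
          m (fibreEquiv (fun x : A.L => x) σ x ⟨y, c⟩) := by
      rw [LinearEquiv.symm_apply_eq, PiTensorProduct.subsingletonEquiv_apply_tprod]
      rfl
    simp only [LinearMap.compMultilinearMap_apply, LinearMap.comp_apply, LinearEquiv.coe_coe, h,
      LinearMap.id_apply]
    exact flatten_tprod (fibreEquiv (fun x : A.L => x) σ x) (fun z => B.V z.1) m
  exact LinearMap.congr_fun this t

theorem Hom.id_comp {A B : VecDelta.{u}} (f : Hom A B) : (Hom.id A).comp f = f := by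
  have key : ∀ x, ((Hom.id A).comp f).lin x = f.lin x := by
    intro x
    refine LinearMap.ext fun v => ?_
    have h1 := map_subsingletonEquiv_symm (⟨x, rfl⟩ : {y : A.L // y = x})
      (s := fun y => A.V y.1) (t := fun x' : {x' : A.L // x' = x} =>
        ⨂[ℂ] y : {y : B.L // f.σ y = x'.1}, B.V y) (fun y => f.lin y.1) v
    exact (congrArg (flatten (fibreEquiv (fun x : A.L => x) f.σ x) fun z => B.V z.1) h1).trans
      (Hom.id_comp_aux f.σ x (f.lin x v))
  exact congrArg (Hom.mk f.σ f.surj) (funext key)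

theorem Hom.comp_id {A B : VecDelta.{u}} (f : Hom A B) : f.comp (Hom.id B) = f := by
  obtain ⟨σ, hσ, lin⟩ := f
  unfold Hom.comp Hom.id
  congr 1
  funext x
  ext v
  simp only [LinearMap.comp_apply, LinearEquiv.coe_coe]
  generalize lin x v = t
  have : (flatten (fibreEquiv σ (fun y : B.L => y) x) (fun z => B.V z.1)).toLinearMap ∘ₗ
      PiTensorProduct.map (fun y : {y : B.L // σ y = x} => (PiTensorProduct.subsingletonEquiv (R := ℂ)
        (s := fun z : {z : B.L // z = y.1} => B.V z) ⟨y.1, rfl⟩).symm.toLinearMap) =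
      LinearMap.id := by
    ext m
    have h : ∀ y : {y : B.L // σ y = x}, (PiTensorProduct.subsingletonEquiv (R := ℂ)
        (s := fun z : {z : B.L // z = y.1} => B.V z) ⟨y.1, rfl⟩).symm (m y) =
        PiTensorProduct.tprod ℂ fun c => m (fibreEquiv σ (fun y : B.L => y) x ⟨y, c⟩) := by
      intro y
      rw [LinearEquiv.symm_apply_eq, PiTensorProduct.subsingletonEquiv_apply_tprod]
      rfl
    simp only [LinearMap.compMultilinearMap_apply, LinearMap.comp_apply, LinearEquiv.coe_coe,
      PiTensorProduct.map_tprod, h, LinearMap.id_apply]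
    exact flatten_tprod (fibreEquiv σ (fun y : B.L => y) x) (fun z => B.V z.1) m
  exact LinearMap.congr_fun this t

theorem map_apply_comp {ι : Type*} {s t r : ι → Type*}
    [∀ i, AddCommMonoid (s i)] [∀ i, Module ℂ (s i)] [∀ i, AddCommMonoid (t i)]
    [∀ i, Module ℂ (t i)] [∀ i, AddCommMonoid (r i)] [∀ i, Module ℂ (r i)]
    (g : ∀ i, t i →ₗ[ℂ] r i) (f : ∀ i, s i →ₗ[ℂ] t i) (v : ⨂[ℂ] i, s i) :
    PiTensorProduct.map (fun i => g i ∘ₗ f i) v = PiTensorProduct.map g (PiTensorProduct.map f v) := by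
  rw [PiTensorProduct.map_comp]; rfl

/-- Regrouping is natural. -/
theorem flatten_map {Y Z : Type u} {C : Y → Type u} [Finite Y] [Finite Z] (e : (Σ y, C y) ≃ Z)
    (M N : Z → Type u) [∀ z, AddCommMonoid (M z)] [∀ z, Module ℂ (M z)]
    [∀ z, AddCommMonoid (N z)] [∀ z, Module ℂ (N z)] (f : ∀ z, M z →ₗ[ℂ] N z)
    (v : ⨂[ℂ] y, ⨂[ℂ] c : C y, M (e ⟨y, c⟩)) :
    PiTensorProduct.map f (flatten e M v) = flatten e N
      (PiTensorProduct.map (fun y => PiTensorProduct.map fun c : C y => f (e ⟨y, c⟩)) v) := by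
  have : PiTensorProduct.map f ∘ₗ (flatten e M).toLinearMap = (flatten e N).toLinearMap ∘ₗ
      PiTensorProduct.map (fun y => PiTensorProduct.map fun c : C y => f (e ⟨y, c⟩)) := by
    refine nested_ext e M fun m => ?_
    simp only [LinearMap.comp_apply, LinearEquiv.coe_coe, flatten_tprod,
      PiTensorProduct.map_tprod]
    exact (flatten_tprod e N fun z => f z (m z)).symm
  exact LinearMap.congr_fun this v

theorem flatten_flatten {I J K H : Type u} [Finite I] [Finite J] [Finite K] [Finite H]
    (σ : J → I) (τ : K → J) (υ : H → K) (x : I)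
    (U : H → Type u) [∀ w, AddCommMonoid (U w)] [∀ w, Module ℂ (U w)]
    (s : ⨂[ℂ] y : {y : J // σ y = x}, ⨂[ℂ] z : {z : K // τ z = y.1},
      ⨂[ℂ] w : {w : H // υ w = z.1}, U w.1) :
    flatten (fibreEquiv (fun z => σ (τ z)) υ x) (fun w => U w.1)
      (flatten (fibreEquiv σ τ x) (fun z => ⨂[ℂ] w : {w : H // υ w = z.1}, U w.1) s) =
    flatten (fibreEquiv σ (fun w => τ (υ w)) x) (fun w => U w.1)
      (PiTensorProduct.map (fun y : {y : J // σ y = x} =>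
        (flatten (fibreEquiv τ υ y.1) (fun w => U w.1)).toLinearMap) s) := by
  have : (flatten (fibreEquiv (fun z => σ (τ z)) υ x) (fun w => U w.1)).toLinearMap =
    (flatten (fibreEquiv σ (fun w => τ (υ w)) x) (fun w => U w.1)).toLinearMap ∘ₗ
      PiTensorProduct.map (fun y : {y : J // σ y = x} =>
        (flatten (fibreEquiv τ υ y.1) (fun w => U w.1)).toLinearMap) ∘ₗ
      nest (fibreEquiv σ τ x) (fun z => ⨂[ℂ] w : {w : H // υ w = z.1}, U w.1) := by
    refine nested_ext (fibreEquiv (fun z => σ (τ z)) υ x) (fun w => U w.1) fun m => ?_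
    have h1 := flatten_tprod (fibreEquiv (fun z => σ (τ z)) υ x) (fun w => U w.1) m
    have h2 := flatten_tprod (fibreEquiv σ (fun w => τ (υ w)) x) (fun w => U w.1) m
    have h3 : ∀ y : {y : J // σ y = x}, _ := fun y =>
      flatten_tprod (fibreEquiv τ υ y.1) (fun w => U w.1) fun w => m ⟨w.1, by rw [w.2, y.2]⟩
    simp only [LinearMap.comp_apply, LinearEquiv.coe_coe]
    rw [h1, nest_tprod, PiTensorProduct.map_tprod]
    refine h2.symm.trans ?_
    congr 2
    funext y
    exact (h3 y).symm
  obtain ⟨r, rfl⟩ := (nest_bijective (fibreEquiv σ τ x)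
    (fun z => ⨂[ℂ] w : {w : H // υ w = z.1}, U w.1)).2 s
  rw [flatten_nest]
  exact LinearMap.congr_fun this r

theorem Hom.assoc_aux {I J K H : Type u} [Finite I] [Finite J] [Finite K] [Finite H]
    (σ : J → I) (τ : K → J) (υ : H → K) (x : I)
    (V : K → Type u) [∀ w, AddCommMonoid (V w)] [∀ w, Module ℂ (V w)]
    (U : H → Type u) [∀ w, AddCommMonoid (U w)] [∀ w, Module ℂ (U w)]
    (h : ∀ z, V z →ₗ[ℂ] ⨂[ℂ] w : {w : H // υ w = z}, U w.1)
    (s : ⨂[ℂ] y : {y : J // σ y = x}, ⨂[ℂ] z : {z : K // τ z = y.1}, V z.1) :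
    flatten (fibreEquiv (fun z => σ (τ z)) υ x) (fun w => U w.1)
      (PiTensorProduct.map (fun z : {z : K // σ (τ z) = x} => h z.1)
        (flatten (fibreEquiv σ τ x) (fun z => V z.1) s)) =
    flatten (fibreEquiv σ (fun w => τ (υ w)) x) (fun w => U w.1)
      (PiTensorProduct.map (fun y : {y : J // σ y = x} =>
        (flatten (fibreEquiv τ υ y.1) (fun w => U w.1)).toLinearMap ∘ₗ
          PiTensorProduct.map (fun z : {z : K // τ z = y.1} => h z.1)) s) := by
  rw [flatten_map (fibreEquiv σ τ x) (fun z => V z.1)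
    (fun z => ⨂[ℂ] w : {w : H // υ w = z.1}, U w.1) (fun z => h z.1), flatten_flatten,
    map_apply_comp]
  rfl

theorem Hom.assoc {A B D E : VecDelta.{u}} (f : Hom A B) (g : Hom B D) (h : Hom D E) :
    (f.comp g).comp h = f.comp (g.comp h) := by
  have key : ∀ x, ((f.comp g).comp h).lin x = (f.comp (g.comp h)).lin x := by
    intro x
    refine LinearMap.ext fun v => ?_
    have := Hom.assoc_aux f.σ g.σ h.σ x (fun z => D.V z) (fun w => E.V w) h.lin
      (PiTensorProduct.map (fun y : {y // f.σ y = x} => g.lin y.1) (f.lin x v))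
    refine this.trans ?_
    rw [← map_apply_comp]
    rfl
  exact congrArg (Hom.mk _ (f.surj.comp (g.surj.comp h.surj))) (funext key)

instance : Category VecDelta.{u} where
  Hom := Hom
  id := Hom.id
  comp f g := Hom.comp f g
  id_comp := Hom.id_comp
  comp_id := Hom.comp_id
  assoc := Hom.assoc

/-- The map `⨂_x V_x → ⨂_y V'_y` induced by a morphism `(V, L) ⟶ (V', L')`. -/
def wMap {A B : VecDelta.{u}} (f : Hom A B) :
    (⨂[ℂ] x, A.V x) →ₗ[ℂ] ⨂[ℂ] y, B.V y :=
  (flatten (totalEquiv f.σ) (fun y => B.V y)).toLinearMap ∘ₗ PiTensorProduct.map f.lin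

theorem wMap_id (A : VecDelta.{u}) : wMap (Hom.id A) = LinearMap.id := by
  ext m
  have h : ∀ x, (Hom.id A).lin x (m x) = PiTensorProduct.tprod ℂ fun c : {y : A.L // y = x} =>
      m c.1 := by
    intro x
    refine (LinearEquiv.symm_apply_eq _).2 ?_
    exact (PiTensorProduct.subsingletonEquiv_apply_tprod (R := ℂ)
      (⟨x, rfl⟩ : {y : A.L // y = x}) (fun c => m c.1)).symm
  simp only [wMap, LinearMap.compMultilinearMap_apply, LinearMap.comp_apply,
    PiTensorProduct.map_tprod, LinearEquiv.coe_coe, LinearMap.id_apply]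
  refine Eq.trans ?_ (flatten_tprod (totalEquiv (fun x : A.L => x)) (fun y => A.V y) m)
  exact congrArg _ (congrArg _ (funext h))

theorem flatten_flatten_total {I J K : Type u} [Finite I] [Finite J] [Finite K]
    (σ : J → I) (τ : K → J)
    (U : K → Type u) [∀ w, AddCommMonoid (U w)] [∀ w, Module ℂ (U w)]
    (s : ⨂[ℂ] x : I, ⨂[ℂ] y : {y : J // σ y = x}, ⨂[ℂ] z : {z : K // τ z = y.1}, U z.1) :
    flatten (totalEquiv τ) U
      (flatten (totalEquiv σ) (fun y => ⨂[ℂ] z : {z : K // τ z = y}, U z.1) s) =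
    flatten (totalEquiv (fun z => σ (τ z))) U
      (PiTensorProduct.map (fun x : I =>
        (flatten (fibreEquiv σ τ x) (fun z => U z.1)).toLinearMap) s) := by
  have : (flatten (totalEquiv τ) U).toLinearMap =
    (flatten (totalEquiv (fun z => σ (τ z))) U).toLinearMap ∘ₗ
      PiTensorProduct.map (fun x : I =>
        (flatten (fibreEquiv σ τ x) (fun z => U z.1)).toLinearMap) ∘ₗ
      nest (totalEquiv σ) (fun y => ⨂[ℂ] z : {z : K // τ z = y}, U z.1) := by
    refine nested_ext (totalEquiv τ) U fun m => ?_
    have h1 := flatten_tprod (totalEquiv τ) U m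
    have h2 := flatten_tprod (totalEquiv (fun z => σ (τ z))) U m
    have h3 : ∀ x : I, _ := fun x =>
      flatten_tprod (fibreEquiv σ τ x) (fun z => U z.1) fun z => m z.1
    simp only [LinearMap.comp_apply, LinearEquiv.coe_coe]
    rw [h1, nest_tprod, PiTensorProduct.map_tprod]
    refine h2.symm.trans ?_
    congr 2
    funext x
    exact (h3 x).symm
  obtain ⟨r, rfl⟩ := (nest_bijective (totalEquiv σ)
    (fun y => ⨂[ℂ] z : {z : K // τ z = y}, U z.1)).2 s
  rw [flatten_nest]
  exact LinearMap.congr_fun this r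

theorem wMap_comp {A B D : VecDelta.{u}} (f : Hom A B) (g : Hom B D) :
    wMap (f.comp g) = wMap g ∘ₗ wMap f := by
  refine LinearMap.ext fun t => ?_
  have h1 := flatten_map (totalEquiv f.σ) (fun y => B.V y)
    (fun y => ⨂[ℂ] z : {z : D.L // g.σ z = y}, D.V z.1) g.lin (PiTensorProduct.map f.lin t)
  have h2 := flatten_flatten_total f.σ g.σ (fun z => D.V z)
    (PiTensorProduct.map (fun x => PiTensorProduct.map fun y : {y // f.σ y = x} => g.lin y.1)
      (PiTensorProduct.map f.lin t))
  refine Eq.trans ?_ (h2.symm.trans (congrArg (flatten (totalEquiv g.σ) fun z => D.V z) h1.symm))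
  rw [← map_apply_comp, ← map_apply_comp]
  rfl

/-- The functor `W(V, L) = ⨂_{x ∈ L} V_x`. -/
def W : VecDelta.{u} ⥤ ModuleCat.{u} ℂ where
  obj A := ModuleCat.of ℂ (⨂[ℂ] x, A.V x)
  map f := ModuleCat.ofHom (wMap f)
  map_id A := by
    rw [← ModuleCat.ofHom_id]
    exact congrArg ModuleCat.ofHom (wMap_id A)
  map_comp f g := by
    rw [← ModuleCat.ofHom_comp]
    exact congrArg ModuleCat.ofHom (wMap_comp f g)

end VecDelta
section Lift

variable {C : Type w} [Category.{v} C] [Abelian C] {Y Z : C}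

/-- A complex `E` with an augmentation `e : E₀ ⟶ Z` that makes `E` a (not necessarily projective)
resolution of `Z`. -/
structure IsResolution (E : ChainComplex C ℕ) (e : E.X 0 ⟶ Z) : Prop where
  epi : Epi e
  zero : E.d 1 0 ≫ e = 0
  exact_zero : (ShortComplex.mk _ _ zero).Exact
  exact_succ : ∀ n, (ShortComplex.mk _ _ (E.d_comp_d (n + 2) (n + 1) n)).Exact

/-- A morphism lifts to a chain map from a complex of projectives to any resolution. -/
theorem exists_lift {Q : ChainComplex C ℕ} [∀ n, Projective (Q.X n)] {q : Q.X 0 ⟶ Y}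
    (hq : Q.d 1 0 ≫ q = 0) {E : ChainComplex C ℕ} {e : E.X 0 ⟶ Z}
    (hE : IsResolution E e) (g : Y ⟶ Z) :
    ∃ f : Q ⟶ E, f.f 0 ≫ e = q ≫ g := by
  have := hE.epi
  let f0 : Q.X 0 ⟶ E.X 0 := Projective.factorThru (q ≫ g) e
  have h0 : f0 ≫ e = q ≫ g := Projective.factorThru_comp _ _
  have hz : (Q.d 1 0 ≫ f0) ≫ e = 0 := by
    rw [Category.assoc, h0, ← Category.assoc, hq, zero_comp]
  let f1 : Q.X 1 ⟶ E.X 1 := hE.exact_zero.liftFromProjective (Q.d 1 0 ≫ f0) hz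
  have h1 : f1 ≫ E.d 1 0 = Q.d 1 0 ≫ f0 := hE.exact_zero.liftFromProjective_comp _ hz
  exact ⟨ChainComplex.mkHom _ _ f0 f1 h1 fun n p =>
    ⟨(hE.exact_succ n).liftFromProjective (Q.d (n + 2) (n + 1) ≫ p.2.1)
      (by dsimp only; rw [Category.assoc, p.2.2]; simp),
      (hE.exact_succ n).liftFromProjective_comp _ _⟩, by simpa using h0⟩

/-- Two such lifts are homotopic. -/
theorem lift_homotopy {Q : ChainComplex C ℕ} [∀ n, Projective (Q.X n)]
    {E : ChainComplex C ℕ} {e : E.X 0 ⟶ Z}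
    (hE : IsResolution E e) (f f' : Q ⟶ E) (h : f.f 0 ≫ e = f'.f 0 ≫ e) :
    Nonempty (Homotopy f f') := by
  suffices H : ∀ k : Q ⟶ E, k.f 0 ≫ e = 0 → Nonempty (Homotopy k 0) by
    obtain ⟨t⟩ := H (f - f') (by simp [h])
    exact ⟨Homotopy.equivSubZero.symm t⟩
  intro k hk
  let s0 : Q.X 0 ⟶ E.X 1 := hE.exact_zero.liftFromProjective (k.f 0) hk
  have h0 : s0 ≫ E.d 1 0 = k.f 0 := hE.exact_zero.liftFromProjective_comp _ hk
  have hz : (k.f 1 - Q.d 1 0 ≫ s0) ≫ E.d 1 0 = 0 := by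
    rw [Preadditive.sub_comp, Category.assoc, h0, k.comm, sub_self]
  let s1 : Q.X 1 ⟶ E.X 2 := (hE.exact_succ 0).liftFromProjective _ hz
  have h1 : s1 ≫ E.d 2 1 = k.f 1 - Q.d 1 0 ≫ s0 :=
    (hE.exact_succ 0).liftFromProjective_comp _ hz
  have hs : ∀ n (a : Q.X n ⟶ E.X (n + 1)) (b : Q.X (n + 1) ⟶ E.X (n + 2)),
      k.f (n + 1) = Q.d (n + 1) n ≫ a + b ≫ E.d (n + 2) (n + 1) →
      (k.f (n + 2) - Q.d (n + 2) (n + 1) ≫ b) ≫ E.d (n + 2) (n + 1) = 0 := by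
    intro n a b hab
    rw [Preadditive.sub_comp, Category.assoc, k.comm, hab]
    simp
  exact ⟨Homotopy.mkInductive k s0 h0.symm s1 (by rw [h1]; abel) fun n p =>
    ⟨(hE.exact_succ (n + 1)).liftFromProjective _ (hs n p.1 p.2.1 p.2.2), by
      have := (hE.exact_succ (n + 1)).liftFromProjective_comp _ (hs n p.1 p.2.1 p.2.2)
      dsimp only at this
      rw [this]
      abel⟩⟩

/-- The augmentation of a projective resolution. -/
def augmentation (Q : ProjectiveResolution Y) : Q.complex.X 0 ⟶ Y := Q.π.f 0

theorem isResolution_augmentation (Q : ProjectiveResolution Y) :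
    IsResolution Q.complex (augmentation Q) where
  epi := inferInstanceAs (Epi (Q.π.f 0))
  zero := Q.complex_d_comp_π_f_zero
  exact_zero := Q.exact₀
  exact_succ := Q.exact_succ

theorem IsResolution.map {E : ChainComplex C ℕ} {e : E.X 0 ⟶ Z} (hE : IsResolution E e)
    {D : Type*} [Category* D] [Abelian D] (F : C ⥤ D) [F.Additive] [PreservesFiniteLimits F]
    [PreservesFiniteColimits F] :
    IsResolution ((F.mapHomologicalComplex _).obj E) (F.map e) where
  epi := have := hE.epi; preserves_epi_of_preservesColimit F e
  zero := (F.map_comp _ _).symm.trans ((congrArg F.map hE.zero).trans (F.map_zero _ _))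
  exact_zero := hE.exact_zero.map F
  exact_succ n := (hE.exact_succ n).map F

end Lift

/-- An augmented commutative `ℂ`-algebra `P` together with a homomorphism of rings `P → R`. -/
structure AugAlg : Type (u + 1) where
  P : Type u
  [commRing : CommRing P]
  [algebra : Algebra ℂ P]
  aug : P →ₐ[ℂ] ℂ
  R : Type u
  [commRingR : CommRing R]
  ρ : P →+* R

attribute [instance] AugAlg.commRing AugAlg.algebra AugAlg.commRingR

namespace AugAlg

/-- A morphism: compatible homomorphisms `P → P'` and `R → R'`, the first one `ℂ`-linear and
compatible with the augmentations. -/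
@[ext]
structure Hom (D E : AugAlg.{u}) : Type u where
  φ : D.P →ₐ[ℂ] E.P
  ψ : D.R →+* E.R
  aug_comp : E.aug.comp φ = D.aug
  comm : ψ.comp D.ρ = E.ρ.comp φ.toRingHom

instance : Category AugAlg.{u} where
  Hom := Hom
  id D := ⟨AlgHom.id ℂ D.P, RingHom.id D.R, rfl, rfl⟩
  comp {D E F} f g := ⟨g.φ.comp f.φ, g.ψ.comp f.ψ,
    by rw [← AlgHom.comp_assoc, g.aug_comp, f.aug_comp],
    by
      rw [RingHom.comp_assoc, f.comm, ← RingHom.comp_assoc, g.comm]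
      rfl⟩

variable (D : AugAlg.{u})

/-- `R` as a `P`-module. -/
def modR : ModuleCat.{u} D.P := (ModuleCat.restrictScalars D.ρ).obj (ModuleCat.of D.R D.R)

/-- `ℂ` as a `P`-module through the augmentation. The `ULift` only adjusts the universe. -/
def modC : ModuleCat.{u} D.P :=
  (ModuleCat.restrictScalars D.aug.toRingHom).obj (ModuleCat.of ℂ (ULift.{u} ℂ))

/-- A `P`-module regarded as a complex vector space. -/
def toVec : ModuleCat.{u} D.P ⥤ ModuleCat.{u} ℂ := ModuleCat.restrictScalars (algebraMap ℂ D.P)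

/-- The complex vector space `Tor_p^P(R, ℂ)`. -/
def tor (p : ℕ) : ModuleCat.{u} ℂ :=
  D.toVec.obj (((Tor (ModuleCat.{u} D.P) p).obj D.modR).obj D.modC)

/-- The functor `M ↦ R ⊗_P M`, with values in complex vector spaces. -/
def tensorR : ModuleCat.{u} D.P ⥤ ModuleCat.{u} ℂ :=
  (MonoidalCategory.tensoringLeft _).obj D.modR ⋙ D.toVec

instance : D.toVec.Additive := by unfold toVec; infer_instance
instance : D.tensorR.Additive := by unfold tensorR; infer_instance
instance : PreservesFiniteLimits D.toVec := by unfold toVec; infer_instance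
instance : PreservesFiniteColimits D.toVec := by unfold toVec; infer_instance

/-- `Tor_p^P(R, ℂ)` is the `p`-th homology of `R ⊗_P Q` for the chosen projective resolution `Q` of
`ℂ`. -/
def torIso (p : ℕ) : D.tor p ≅
    ((D.tensorR.mapHomologicalComplex (ComplexShape.down ℕ)).obj
      (projectiveResolution D.modC).complex).homology p :=
  D.toVec.mapIso ((projectiveResolution D.modC).isoLeftDerivedObj
      ((MonoidalCategory.tensoringLeft _).obj D.modR) p) ≪≫
    (ShortComplex.mapHomologyIso _ D.toVec).symm

variable {D} {E F : AugAlg.{u}}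

/-- Restriction of scalars along the ring homomorphism underlying a morphism. -/
def res (f : D ⟶ E) : ModuleCat.{u} E.P ⥤ ModuleCat.{u} D.P :=
  ModuleCat.restrictScalars f.φ.toRingHom

instance (f : D ⟶ E) : (res f).Additive := by unfold res; infer_instance
instance (f : D ⟶ E) : PreservesFiniteLimits (res f) := by unfold res; infer_instance
instance (f : D ⟶ E) : PreservesFiniteColimits (res f) := by unfold res; infer_instance

/-- The identity of `ℂ`, as a `P`-linear map. -/
def modCMap (f : D ⟶ E) : D.modC ⟶ (res f).obj E.modC :=
  ModuleCat.ofHom (X := D.modC) (Y := (res f).obj E.modC)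
    { toFun := fun z => z
      map_add' := fun _ _ => rfl
      map_smul' := fun a z => by
        have h : E.aug (f.φ a) = D.aug a := DFunLike.congr_fun f.aug_comp a
        exact congrArg (fun c : ℂ => c • (show ULift.{u} ℂ from z)) h.symm }

/-- The map `R → R'`, on the underlying modules. -/
def psi (f : D ⟶ E) : D.modR →+ E.modR := f.ψ.toAddMonoidHom

theorem psi_smul (f : D ⟶ E) (a : D.P) (r : D.modR) : psi f (a • r) = f.φ a • psi f r := by
  have h : f.ψ (D.ρ a) = E.ρ (f.φ a) := DFunLike.congr_fun f.comm a
  exact (f.ψ.map_mul (D.ρ a) r).trans (congrArg (fun c => c * f.ψ r) h)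

/-- The additive map underlying `R ⊗_P M → R' ⊗_{P'} M`. -/
def tensorAddHom (f : D ⟶ E) (M : ModuleCat.{u} E.P) :
    D.modR ⊗[D.P] (res f).obj M →+ E.modR ⊗[E.P] M :=
  TensorProduct.liftAddHom (R := D.P) (M := D.modR) (N := (res f).obj M)
    { toFun := fun r =>
        { toFun := fun m => psi f r ⊗ₜ[E.P] (show M from m)
          map_zero' := TensorProduct.tmul_zero _ _
          map_add' := fun _ _ => TensorProduct.tmul_add _ _ _ }
      map_zero' := by
        ext m
        exact (congrArg (fun r' => r' ⊗ₜ[E.P] (show M from m)) (map_zero (psi f))).trans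
          (TensorProduct.zero_tmul _ _)
      map_add' := fun r s => by
        ext m
        exact (congrArg (fun r' => r' ⊗ₜ[E.P] (show M from m)) (map_add (psi f) r s)).trans
          (TensorProduct.add_tmul _ _ _) }
    (fun a r m => by
      exact (congrArg (fun r' => r' ⊗ₜ[E.P] (show M from m)) (psi_smul f a r)).trans
        (TensorProduct.smul_tmul (f.φ a) (psi f r) (show M from m)))

theorem tensorAddHom_tmul (f : D ⟶ E) (M : ModuleCat.{u} E.P) (r : D.modR) (m : (res f).obj M) :
    tensorAddHom f M (r ⊗ₜ[D.P] m) = psi f r ⊗ₜ[E.P] (show M from m) := rfl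

theorem tensorAddHom_smul (f : D ⟶ E) (M : ModuleCat.{u} E.P) (a : D.P)
    (t : D.modR ⊗[D.P] (res f).obj M) :
    tensorAddHom f M (a • t) = f.φ a • tensorAddHom f M t := by
  induction t with
  | zero => simp
  | add x y hx hy => rw [smul_add, map_add, hx, hy, map_add, smul_add]
  | tmul r m =>
    rw [← TensorProduct.tmul_smul, tensorAddHom_tmul, tensorAddHom_tmul, ← TensorProduct.tmul_smul]
    rfl

/-- The natural map `R ⊗_P M → R' ⊗_{P'} M` for a `P'`-module `M`. -/
def tensorMap (f : D ⟶ E) (M : ModuleCat.{u} E.P) :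
    D.tensorR.obj ((res f).obj M) ⟶ E.tensorR.obj M :=
  ModuleCat.ofHom (X := D.tensorR.obj ((res f).obj M)) (Y := E.tensorR.obj M)
    { toFun := tensorAddHom f M
      map_add' := fun _ _ => map_add _ _ _
      map_smul' := fun c t => by
        refine (tensorAddHom_smul f M (algebraMap ℂ D.P c) t).trans ?_
        rw [f.φ.commutes]
        rfl }

theorem tensor_ext {M : ModuleCat.{u} D.P} {N : ModuleCat.{u} ℂ} {a b : D.tensorR.obj M ⟶ N}
    (h : ∀ (r : D.modR) (m : M), a.hom (r ⊗ₜ[D.P] m : D.modR ⊗[D.P] M) =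
      b.hom (r ⊗ₜ[D.P] m : D.modR ⊗[D.P] M)) : a = b := by
  ext t
  refine TensorProduct.induction_on (motive := fun t : D.modR ⊗[D.P] M => a.hom t = b.hom t)
    t ?_ h ?_
  · exact (map_zero a.hom).trans (map_zero b.hom).symm
  · intro x y hx hy
    exact (map_add a.hom x y).trans ((congrArg₂ (· + ·) hx hy).trans (map_add b.hom x y).symm)

theorem tensorR_map_tmul {M N : ModuleCat.{u} D.P} (k : M ⟶ N) (r : D.modR) (m : M) :
    (D.tensorR.map k).hom (r ⊗ₜ[D.P] m : D.modR ⊗[D.P] M) =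
      (r ⊗ₜ[D.P] k.hom m : D.modR ⊗[D.P] N) := rfl

theorem tensorMap_tmul (f : D ⟶ E) (M : ModuleCat.{u} E.P) (r : D.modR) (m : M) :
    (tensorMap f M).hom ((show D.modR from r) ⊗ₜ[D.P] (show (res f).obj M from m) :
      D.modR ⊗[D.P] (res f).obj M) =
      (psi f r ⊗ₜ[E.P] m : E.modR ⊗[E.P] M) := rfl

theorem tensorMap_naturality (f : D ⟶ E) {M N : ModuleCat.{u} E.P} (k : M ⟶ N) :
    D.tensorR.map ((res f).map k) ≫ tensorMap f N = tensorMap f M ≫ E.tensorR.map k :=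
  tensor_ext fun _ _ => rfl

theorem tensorMap_comm (f : D ⟶ E) {A B : ModuleCat.{u} D.P} {M N : ModuleCat.{u} E.P}
    (a : A ⟶ (res f).obj M) (b : B ⟶ (res f).obj N) (d : A ⟶ B) (d' : M ⟶ N)
    (h : a ≫ (res f).map d' = d ≫ b) :
    (D.tensorR.map a ≫ tensorMap f M) ≫ E.tensorR.map d' =
      D.tensorR.map d ≫ D.tensorR.map b ≫ tensorMap f N := by
  rw [Category.assoc, ← tensorMap_naturality, ← Category.assoc, ← Functor.map_comp, h,
    Functor.map_comp, Category.assoc]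

/-- The chain map `R ⊗_P Q → R' ⊗_{P'} Q'` of complexes of vector spaces induced by a `P`-linear
chain map `Q → Q'`. -/
def tensorChain (f : D ⟶ E) {Q : ChainComplex (ModuleCat.{u} D.P) ℕ}
    {Q' : ChainComplex (ModuleCat.{u} E.P) ℕ}
    (k : Q ⟶ ((res f).mapHomologicalComplex _).obj Q') :
    (D.tensorR.mapHomologicalComplex _).obj Q ⟶ (E.tensorR.mapHomologicalComplex _).obj Q' where
  f i := D.tensorR.map (k.f i) ≫ tensorMap f (Q'.X i)
  comm' i j _ := by
    exact tensorMap_comm f (k.f i) (k.f j) (Q.d i j) (Q'.d i j) (k.comm i j)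

theorem tensorChain_eq (f : D ⟶ E) {Q : ChainComplex (ModuleCat.{u} D.P) ℕ}
    {Q' : ChainComplex (ModuleCat.{u} E.P) ℕ}
    (k : Q ⟶ ((res f).mapHomologicalComplex _).obj Q') :
    tensorChain f k = (D.tensorR.mapHomologicalComplex _).map k ≫
      tensorChain f (𝟙 (((res f).mapHomologicalComplex _).obj Q')) := by
  ext1 i
  exact tensor_ext fun _ _ => rfl

/-- The `P`-linear chain map from the chosen projective resolution of `ℂ` over `P` to the one over
`P'` extending the identity of `ℂ`; it is unique up to homotopy. -/
theorem exists_chain (f : D ⟶ E) :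
    ∃ k : (projectiveResolution D.modC).complex ⟶
      ((res f).mapHomologicalComplex _).obj (projectiveResolution E.modC).complex,
      k.f 0 ≫ (res f).map (augmentation (projectiveResolution E.modC)) =
        augmentation (projectiveResolution D.modC) ≫ modCMap f :=
  exists_lift (isResolution_augmentation (projectiveResolution D.modC)).zero
    ((isResolution_augmentation (projectiveResolution E.modC)).map (res f)) (modCMap f)

/-- The change-of-rings map `Tor_p^P(R, ℂ) → Tor_p^{P'}(R', ℂ)`: choose a `P`-linear chain map from
the projective resolution `Q` of `ℂ` over `P` to the one `Q'` over `P'` extending the identity of `ℂ`,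
and take homology of the resulting map `R ⊗_P Q → R' ⊗_{P'} Q'`. -/
def torMap (p : ℕ) (f : D ⟶ E) : D.tor p ⟶ E.tor p :=
  (D.torIso p).hom ≫
    HomologicalComplex.homologyMap (tensorChain f (exists_chain f).choose) p ≫ (E.torIso p).inv

/-- The change-of-rings map may be computed from any lift. -/
theorem torMap_eq (p : ℕ) (f : D ⟶ E) (k : (projectiveResolution D.modC).complex ⟶
      ((res f).mapHomologicalComplex _).obj (projectiveResolution E.modC).complex)
    (hk : k.f 0 ≫ (res f).map (augmentation (projectiveResolution E.modC)) =
        augmentation (projectiveResolution D.modC) ≫ modCMap f) :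
    torMap p f = (D.torIso p).hom ≫
      HomologicalComplex.homologyMap (tensorChain f k) p ≫ (E.torIso p).inv := by
  obtain ⟨h⟩ := lift_homotopy
    ((isResolution_augmentation (projectiveResolution E.modC)).map (res f))
    (exists_chain f).choose k ((exists_chain f).choose_spec.trans hk.symm)
  unfold torMap
  rw [tensorChain_eq, tensorChain_eq f k, HomologicalComplex.homologyMap_comp,
    HomologicalComplex.homologyMap_comp, (D.tensorR.mapHomotopy h).homologyMap_eq]

theorem torMap_id (p : ℕ) (D : AugAlg.{u}) : torMap p (𝟙 D) = 𝟙 (D.tor p) := by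
  let Q := (projectiveResolution D.modC).complex
  let k : Q ⟶ ((res (𝟙 D)).mapHomologicalComplex _).obj Q :=
    { f := fun i => (ModuleCat.restrictScalarsId (D.P)).inv.app (Q.X i)
      comm' := fun i j _ => rfl }
  rw [torMap_eq p (𝟙 D) k rfl]
  have : tensorChain (𝟙 D) k = 𝟙 _ := by
    ext1 i
    exact tensor_ext fun _ _ => rfl
  rw [this, HomologicalComplex.homologyMap_id, Category.id_comp, Iso.hom_inv_id]

theorem torMap_comp (p : ℕ) (f : D ⟶ E) (g : E ⟶ F) :
    torMap p (f ≫ g) = torMap p f ≫ torMap p g := by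
  obtain ⟨k, hk⟩ := exists_chain f
  obtain ⟨l, hl⟩ := exists_chain g
  let Q := (projectiveResolution F.modC).complex
  let m : ((res f).mapHomologicalComplex _).obj (((res g).mapHomologicalComplex _).obj Q) ⟶
      ((res (f ≫ g)).mapHomologicalComplex (ComplexShape.down ℕ)).obj Q :=
    { f := fun i => (ModuleCat.restrictScalarsComp f.φ.toRingHom g.φ.toRingHom).inv.app (Q.X i)
      comm' := fun i j _ => rfl }
  rw [torMap_eq p f k hk, torMap_eq p g l hl,
    torMap_eq p (f ≫ g) (k ≫ ((res f).mapHomologicalComplex _).map l ≫ m) ?_]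
  · have : tensorChain (f ≫ g) (k ≫ ((res f).mapHomologicalComplex _).map l ≫ m) =
        tensorChain f k ≫ tensorChain g l := by
      ext1 i
      exact tensor_ext fun _ _ => rfl
    rw [this, HomologicalComplex.homologyMap_comp]
    simp
  · ext x
    have h1 := fun x => congrArg (fun t => t.hom x) hk
    have h2 := fun x => congrArg (fun t => t.hom x) hl
    exact (h2 _).trans (h1 x)

/-- The functor `(P → R) ↦ Tor_p^P(R, ℂ)`. -/
def torFunctor (p : ℕ) : AugAlg.{u} ⥤ ModuleCat.{u} ℂ where
  obj D := D.tor p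
  map f := torMap p f
  map_id D := torMap_id p D
  map_comp f g := torMap_comp p f g

end AugAlg

namespace VecDelta

theorem map_smul_family {ι : Type*} [Fintype ι] {s t : ι → Type*}
    [∀ i, AddCommMonoid (s i)] [∀ i, Module ℂ (s i)] [∀ i, AddCommMonoid (t i)]
    [∀ i, Module ℂ (t i)] (c : ι → ℂ) (g : ∀ i, s i →ₗ[ℂ] t i) (v : ⨂[ℂ] i, s i) :
    PiTensorProduct.map (fun i => c i • g i) v = (∏ i, c i) • PiTensorProduct.map g v := by
  have : PiTensorProduct.map (fun i => c i • g i) = (∏ i, c i) • PiTensorProduct.map g := by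
    ext m
    simp [MultilinearMap.map_smul_univ]
  rw [this]; rfl

/-- The morphism obtained from `f` by multiplying the map at each `x` by the scalar `c x`. -/
def Hom.twist {A B : VecDelta.{u}} (f : Hom A B) (c : A.L → ℂ) : Hom A B where
  σ := f.σ
  surj := f.surj
  lin x := c x • f.lin x

theorem Hom.twist_comp {A B D : VecDelta.{u}} (f : Hom A B) (c : A.L → ℂ) (g : Hom B D) :
    (f.twist c).comp g = (f.comp g).twist c := by
  unfold Hom.comp Hom.twist
  congr 1
  funext x
  ext v
  simp

theorem Hom.comp_twist {A B D : VecDelta.{u}} (f : Hom A B) (g : Hom B D) (c : B.L → ℂ)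
    (c' : A.L → ℂ) [∀ x, Fintype {y // f.σ y = x}]
    (h : ∀ x, ∏ y : {y // f.σ y = x}, c y.1 = c' x) :
    f.comp (g.twist c) = (f.comp g).twist c' := by
  unfold Hom.comp Hom.twist
  congr 1
  funext x
  ext v
  simp only [LinearMap.comp_apply, LinearEquiv.coe_coe, LinearMap.smul_apply]
  rw [map_smul_family, h, map_smul]

open Classical in
/-- The endomorphism of `(V, L)` multiplying `V_x` by `t` and leaving the other spaces alone. -/
def scale (A : VecDelta.{u}) (x : A.L) (t : ℂ) : A ⟶ A :=
  (Hom.id A).twist fun y => if y = x then t else 1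

/-- Scaling commutes with morphisms. -/
theorem comp_scale {A B : VecDelta.{u}} (f : A ⟶ B) (y : B.L) (t : ℂ) :
    f ≫ scale B y t = scale A (Hom.σ f y) t ≫ f := by
  classical
  have : ∀ x, Fintype {z // Hom.σ f z = x} := fun x => Fintype.ofFinite _
  have hc : ∀ x, (∏ z : {z // Hom.σ f z = x}, if z.1 = y then t else (1 : ℂ)) =
      if x = Hom.σ f y then t else 1 := by
    intro x
    split_ifs with hx
    · rw [Finset.prod_eq_single ⟨y, hx.symm⟩]
      · simp
      · intro z _ hz
        rw [if_neg]
        exact fun h => hz (Subtype.ext h)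
      · simp
    · refine Finset.prod_eq_one fun z _ => ?_
      rw [if_neg]
      rintro rfl
      exact hx z.2.symm
  have h1 := Hom.comp_twist f (Hom.id B) (fun z => if z = y then t else 1)
    (fun x => if x = Hom.σ f y then t else 1) hc
  have h2 := Hom.twist_comp (Hom.id A) (fun x => if x = Hom.σ f y then t else 1) f
  rw [Hom.comp_id] at h1
  rw [Hom.id_comp] at h2
  have h : Hom.comp f (scale B y t) = Hom.comp (scale A (Hom.σ f y) t) f := by
    unfold scale
    exact h1.trans h2.symm
  exact h

/-- The inclusion into `VecDelta` of the category of families of vector spaces indexed by a fixed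
set `L` and families of linear maps between them. -/
def family (L : Type u) [Finite L] [Nonempty L] : (L → ModuleCat.{u} ℂ) ⥤ VecDelta.{u} where
  obj V := { L := L, V := V }
  map {V V'} g :=
    { σ := fun x => x
      surj := Function.surjective_id
      lin := fun x => (PiTensorProduct.subsingletonEquiv (R := ℂ)
        (s := fun y : {y : L // y = x} => V' y) ⟨x, rfl⟩).symm.toLinearMap ∘ₗ (g x).hom }
  map_id V := rfl
  map_comp {V V' V''} g h := by
    refine congrArg (Hom.mk (A := { L := L, V := V }) (B := { L := L, V := V'' })
      (fun x => x) Function.surjective_id) (funext fun x => LinearMap.ext fun v => ?_)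
    have h1 := map_subsingletonEquiv_symm (⟨x, rfl⟩ : {y : L // y = x})
      (s := fun y => V' y.1) (fun y : {y : L // y = x} => (PiTensorProduct.subsingletonEquiv (R := ℂ)
        (s := fun z : {z : L // z = y.1} => V'' z) ⟨y.1, rfl⟩).symm.toLinearMap ∘ₗ (h y.1).hom)
      ((g x).hom v)
    exact ((congrArg (flatten (fibreEquiv (fun x : L => x) (fun x : L => x) x)
      (fun z => V'' z.1)) h1).trans
      (flatten_subsingletonEquiv_symm (fun x : L => x) x (fun y => V'' y) _)).symm

end VecDelta

/-- `F` is a subquotient of `G`: a quotient of a subobject of `G`. In a category of functors to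
vector spaces this is the pointwise notion. -/
def IsSubquotient {C : Type*} [Category* C] (F G : C) : Prop :=
  ∃ (S : C) (i : S ⟶ G) (q : S ⟶ F), Mono i ∧ Epi q

/-- The functor `(V_x)_{x ∈ L} ↦ ⨂_x V_x^{⊗ n_x}`. -/
def tensorPowers {L : Type u} (n : L → ℕ) : (L → ModuleCat.{u} ℂ) ⥤ ModuleCat.{u} ℂ where
  obj V := ModuleCat.of ℂ (⨂[ℂ] x, ⨂[ℂ] _ : Fin (n x), V x)
  map g := ModuleCat.ofHom
    (PiTensorProduct.map fun x => PiTensorProduct.map fun _ : Fin (n x) => (g x).hom)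
  map_id V := by
    refine ModuleCat.hom_ext ?_
    simp
  map_comp g h := by
    refine ModuleCat.hom_ext ?_
    simp [PiTensorProduct.map_comp]

/-- A functor of `L`-indexed families of vector spaces is *nice* if it is a (possibly infinite)
direct sum of constituents of functors `(V_x) ↦ ⨂_x V_x^{⊗ n_x}`. -/
def IsNice {L : Type u} (G : (L → ModuleCat.{u} ℂ) ⥤ ModuleCat.{u} ℂ) : Prop :=
  ∃ (I : Type u) (n : I → L → ℕ) (H : I → (L → ModuleCat.{u} ℂ) ⥤ ModuleCat.{u} ℂ),
    (∀ i, IsSubquotient (H i) (tensorPowers (n i))) ∧ Nonempty (G ≅ ∐ H)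

/-- A `Δ`-module is a functor from `VecDelta` to complex vector spaces that is nice as a functor of
the vector spaces, for every index set `L`. -/
def IsDeltaModule (F : VecDelta.{u} ⥤ ModuleCat.{u} ℂ) : Prop :=
  ∀ (L : Type u) [Finite L] [Nonempty L], IsNice (VecDelta.family L ⋙ F)

/-- The `Δ`-module `Φ(T_n) : (V, L) ↦ (⨂_{x ∈ L} V_x)^{⊗ n} = ⨂_{x ∈ L} V_x^{⊗ n}`. For positive
`n` it is the free `Δ`-module on the functor `T_n` that sends a one-element family `V` to `V^{⊗ n}`
and all other families to `0`: of the sum over the partitions of `L` that describes a free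
`Δ`-module, only the partition with a single block survives. -/
def PhiT (n : ℕ) : VecDelta.{u} ⥤ ModuleCat.{u} ℂ where
  obj A := ModuleCat.of ℂ (⨂[ℂ] _ : Fin n, VecDelta.W.obj A)
  map f := ModuleCat.ofHom (PiTensorProduct.map fun _ : Fin n => (VecDelta.W.map f).hom)
  map_id A := by
    refine ModuleCat.hom_ext ?_
    simp
  map_comp f g := by
    refine ModuleCat.hom_ext ?_
    simp [PiTensorProduct.map_comp]

/-- `F` is small: a subquotient of a finite direct sum of `Δ`-modules `Φ(T_n)`, with positive `n`
that may vary. -/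
def IsSmall (F : VecDelta.{u} ⥤ ModuleCat.{u} ℂ) : Prop :=
  ∃ (k : ℕ) (n : Fin k → ℕ), (∀ i, 0 < n i) ∧ IsSubquotient F (∐ fun i => PhiT.{u} (n i))

/-- The degree `d` piece of a functor on `VecDelta`: the elements of `F(V, L)` on which, for every
`x ∈ L` and every scalar `t`, the endomorphism of `(V, L)` multiplying `V_x` by `t` acts as `t ^ d`.
Since that endomorphism multiplies `⨂_x V_x` by `t`, it acts as `t ^ d` on the degree `d` part of the
polynomial ring `Sym(⨂_x V_x)`, on the degree `d` part of a graded quotient of it, and on the degree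
`d` part of a `Tor` of such graded modules. -/
def degreePiece (F : VecDelta.{u} ⥤ ModuleCat.{u} ℂ) (d : ℕ) : VecDelta.{u} ⥤ ModuleCat.{u} ℂ where
  obj A := ModuleCat.of ℂ
    ({ carrier := {z | ∀ (x : A.L) (t : ℂ), (F.map (A.scale x t)).hom z = t ^ d • z}
       add_mem' := fun ha hb x t => by rw [map_add, ha x t, hb x t, smul_add]
       zero_mem' := fun x t => by rw [map_zero, smul_zero]
       smul_mem' := fun c z hz x t => by rw [map_smul, hz x t, smul_comm] } :
      Submodule ℂ (F.obj A))
  map {A B} f := ModuleCat.ofHom ((F.map f).hom.restrict fun z hz y t => by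
    have h := congrArg (fun k => (F.map k).hom z) (VecDelta.comp_scale f y t)
    simp only [F.map_comp, ModuleCat.hom_comp, LinearMap.comp_apply] at h
    rw [h, hz, map_smul])
  map_id A := by
    refine ModuleCat.hom_ext (LinearMap.ext fun z => Subtype.ext ?_)
    exact LinearMap.congr_fun (congrArg ModuleCat.Hom.hom (F.map_id A)) z.1
  map_comp f g := by
    refine ModuleCat.hom_ext (LinearMap.ext fun z => Subtype.ext ?_)
    exact LinearMap.congr_fun (congrArg ModuleCat.Hom.hom (F.map_comp f g)) z.1

/-- The homomorphism `Sym(⨂_x V_x) → Sym(⨂_y V'_y)` induced by a morphism `(V, L) ⟶ (V', L')`. -/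
def polyMap {A B : VecDelta.{u}} (f : A ⟶ B) :
    SymmetricAlgebra ℂ (VecDelta.W.obj A) →ₐ[ℂ] SymmetricAlgebra ℂ (VecDelta.W.obj B) :=
  SymmetricAlgebra.lift (SymmetricAlgebra.ι ℂ _ ∘ₗ (VecDelta.W.map f).hom)

theorem polyMap_id (A : VecDelta.{u}) : polyMap (𝟙 A) = AlgHom.id ℂ _ := by
  refine SymmetricAlgebra.algHom_ext (LinearMap.ext fun w => ?_)
  simp [polyMap]

theorem polyMap_comp {A B D : VecDelta.{u}} (f : A ⟶ B) (g : B ⟶ D) :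
    polyMap (f ≫ g) = (polyMap g).comp (polyMap f) := by
  refine SymmetricAlgebra.algHom_ext (LinearMap.ext fun w => ?_)
  simp [polyMap]

/-- The functor `P(V, L) = Sym(⨂_{x ∈ L} V_x)`. -/
def poly : VecDelta.{u} ⥤ CommRingCat.{u} where
  obj A := CommRingCat.of (SymmetricAlgebra ℂ (VecDelta.W.obj A))
  map f := CommRingCat.ofHom (polyMap f).toRingHom
  map_id A := by rw [polyMap_id]; rfl
  map_comp f g := by rw [polyMap_comp]; rfl

/-- The space `⨂_{x ∈ L} V_x^*` regarded as a scheme, that is, the spectrum of its coordinate ring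
`Sym(⨂_{x ∈ L} V_x)`. It is contravariant in `(V, L)`. -/
def affineSpace : VecDelta.{u}ᵒᵖ ⥤ Scheme.{u} := poly.op ⋙ Scheme.Spec

/-- A `Δ`-scheme: a (contravariant) functor `X` from `VecDelta` to schemes with nonempty values, and
a natural closed immersion `i` of `X` into `(V, L) ↦ ⨂_{x ∈ L} V_x^*`. The immersion makes every
`X(V, L)` a scheme over `ℂ` and, being natural, every transition map a morphism over `ℂ`. -/
structure DeltaScheme : Type (u + 1) where
  X : VecDelta.{u}ᵒᵖ ⥤ Scheme.{u}
  nonempty : ∀ A, Nonempty (X.obj A)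
  i : X ⟶ affineSpace
  isClosedImmersion : ∀ A, IsClosedImmersion (i.app A)

namespace DeltaScheme

variable (X : DeltaScheme.{u})

/-- The affine coordinate ring `R(V, L)` of `X(V, L)`. -/
def R : VecDelta.{u} ⥤ CommRingCat.{u} := X.X.rightOp ⋙ Scheme.Γ

/-- Restriction of functions `P(V, L) → R(V, L)`. -/
def ρ : poly.{u} ⟶ X.R where
  app A := (Scheme.ΓSpecIso (poly.obj A)).inv ≫ (X.i.app (Opposite.op A)).appTop
  naturality A B f := by
    have h := congrArg Scheme.Hom.appTop (X.i.naturality f.op)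
    simp only [Scheme.Hom.comp_appTop] at h
    have h2 := Scheme.ΓSpecIso_inv_naturality (poly.map f)
    have h3 := congrArg (fun k => k ≫ (X.i.app (Opposite.op B)).appTop) h2
    have h4 := congrArg (fun k => (Scheme.ΓSpecIso (poly.obj A)).inv ≫ k) h
    exact (Category.assoc _ _ _).symm.trans (h3.trans ((Category.assoc _ _ _).trans
      (h4.symm.trans (Category.assoc _ _ _).symm)))

/-- The functor `(V, L) ↦ (P(V, L) → R(V, L))`, where `P(V, L)` is augmented by
`P(V, L) → ℂ`, killing `⨂_x V_x`. -/
def augAlg : VecDelta.{u} ⥤ AugAlg.{u} where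
  obj A :=
    { P := SymmetricAlgebra ℂ (VecDelta.W.obj A)
      aug := SymmetricAlgebra.algebraMapInv
      R := X.R.obj A
      ρ := (X.ρ.app A).hom }
  map {A B} f :=
    { φ := polyMap f
      ψ := (X.R.map f).hom
      aug_comp := by
        refine SymmetricAlgebra.algHom_ext (LinearMap.ext fun w => ?_)
        have h : ∀ (A : VecDelta.{u}) (w : VecDelta.W.obj A),
            SymmetricAlgebra.algebraMapInv (R := ℂ) (SymmetricAlgebra.ι ℂ _ w) = 0 :=
          fun A w => SymmetricAlgebra.algebraMapInv_ι w
        simp [polyMap, h]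
      comm := congrArg CommRingCat.Hom.hom (X.ρ.naturality f).symm }
  map_id A := AugAlg.Hom.ext (polyMap_id A) (congrArg CommRingCat.Hom.hom (X.R.map_id A))
  map_comp f g := AugAlg.Hom.ext (polyMap_comp f g)
    (congrArg CommRingCat.Hom.hom (X.R.map_comp f g))

/-- The syzygy functors `F_p(V, L) = Tor_p^{P(V, L)}(R(V, L), ℂ)`. -/
def syzygy (p : ℕ) : VecDelta.{u} ⥤ ModuleCat.{u} ℂ := X.augAlg ⋙ AugAlg.torFunctor p

end DeltaScheme
end DeltaSyz

end

/-!
The vector spaces `F_p = Tor_p^P(R, ℂ)` are computed by the Koszul resolution `Sym W ⊗ ⋀ W` of `ℂ`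
over `P = Sym W`, where `W = ⨂_x V_x`. The resolution is functorial in `(V, L)`, and its degree `p`
term is spanned by natural images of the tensor powers `W^{⊗ (m + p)} = PhiT (m + p)`.

Exactness of the Koszul complex rests on characteristic zero: with the Koszul differential `d` and
the exterior differential `δ`, the operator `dδ + δd` multiplies an element of total degree `m` by
`m`, so that a cycle of positive total degree is a boundary (`Koszul.exists_d_eq_of_mem_eig`). Since
`Tor`, with its change-of-rings maps, may be computed from any projective resolution
(`AugAlg.Resolution.torMap_comp_torIso`), there is a natural linear relation between
`Sym W ⊗ ⋀ᵖ W` and `F_p`, relating `m` to the class of `1 ⊗ m` whenever `1 ⊗ m` is a cycle of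
`R ⊗_P (Sym W ⊗ ⋀ W)` (`AugAlg.Resolution.rel`). It is single-valued, and it hits all of `F_p`
because `X` is a closed subscheme, so that `P → R` is surjective. An interpolation in the scalings
of one of the `V_x` isolates the part of degree `d` and shows that the degree `d` piece of `F_p` is a
subquotient of the single functor `PhiT d` (`degreePiece_isSubquotient`). This makes it a
`Δ`-module, and a small one when `d > 0`.

In degree zero there is nothing to estimate: scaling by `0` acts as the identity there, and it
factors through the origin of the affine space, which belongs to `X` because `X(V, L)` is not empty
and is stable under scaling. Hence the degree zero piece of `F_p` is constant with value
`Tor_p^ℂ(ℂ, ℂ)` (`DeltaScheme.degreeZeroIso`), which is `0` for `p > 0` and `ℂ` for `p = 0`.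
-/

noncomputable section

namespace DeltaSyz

/-! ### The Koszul algebra of a vector space -/

section Koszul

variable (k : Type v) [Field k] (W : Type u) [AddCommGroup W] [Module k W]

/-- The Koszul algebra `Sym W ⊗ ⋀ W`, an algebra over `Sym W`. -/
abbrev Koszul : Type max u v := SymmetricAlgebra k W ⊗[k] ExteriorAlgebra k W

namespace Koszul

variable {k W}

/-- The even generator `w ⊗ 1`. -/
def even : W →ₗ[k] Koszul k W :=
  Algebra.TensorProduct.includeLeft.toLinearMap ∘ₗ SymmetricAlgebra.ι k W

/-- The odd generator `1 ⊗ w`. -/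
def odd : W →ₗ[k] Koszul k W :=
  Algebra.TensorProduct.includeRight.toLinearMap ∘ₗ ExteriorAlgebra.ι k

theorem even_apply (w : W) : even (k := k) w = SymmetricAlgebra.ι k W w ⊗ₜ 1 := rfl

theorem odd_apply (w : W) : odd (k := k) w = 1 ⊗ₜ ExteriorAlgebra.ι k w := rfl

theorem odd_mul_self (w : W) : odd (k := k) w * odd w = 0 := by
  simp [odd_apply]

theorem odd_mul_odd_add (v w : W) : odd (k := k) v * odd w + odd w * odd v = 0 := by
  simp [odd_apply, ← TensorProduct.tmul_add]

theorem smul_eq_tmul_mul (p : SymmetricAlgebra k W) (y : Koszul k W) :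
    p • y = p ⊗ₜ[k] 1 * y := Algebra.smul_def p y

theorem even_mul (w : W) (y : Koszul k W) : even w * y = SymmetricAlgebra.ι k W w • y :=
  (smul_eq_tmul_mul _ y).symm

theorem odd_mul_smul (w : W) (p : SymmetricAlgebra k W) (y : Koszul k W) :
    odd w * (p • y) = p • (odd w * y) := mul_smul_comm _ _ _

theorem smul_one_tmul (p : SymmetricAlgebra k W) (x : ExteriorAlgebra k W) :
    p • ((1 : SymmetricAlgebra k W) ⊗ₜ[k] x) = p ⊗ₜ[k] x := by
  rw [TensorProduct.smul_tmul', smul_eq_mul, mul_one]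

/-- A property of elements of the Koszul algebra holds for all of them if it holds for `1` and is
preserved by addition and by the multiplication with even scalars and odd generators. -/
theorem induction {motive : Koszul k W → Prop} (one : motive 1)
    (add : ∀ x y, motive x → motive y → motive (x + y))
    (smul : ∀ (p : SymmetricAlgebra k W) x, motive x → motive (p • x))
    (odd_mul : ∀ w x, motive x → motive (odd w * x)) (z : Koszul k W) : motive z := by
  induction z using TensorProduct.induction_on with
  | zero => simpa using smul 0 1 one
  | add x y hx hy => exact add x y hx hy
  | tmul p x =>
    rw [← smul_one_tmul]
    refine smul p _ ?_
    induction x using CliffordAlgebra.left_induction with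
    | algebraMap r =>
      have : (1 : SymmetricAlgebra k W) ⊗ₜ[k] (algebraMap k (ExteriorAlgebra k W) r) =
          algebraMap k (SymmetricAlgebra k W) r • (1 : Koszul k W) := by
        rw [algebraMap_smul, Algebra.TensorProduct.one_def, ← TensorProduct.tmul_smul,
          Algebra.algebraMap_eq_smul_one]
      exact this ▸ smul _ _ one
    | add x y hx hy => rw [TensorProduct.tmul_add]; exact add _ _ hx hy
    | ι_mul x w hx =>
      have : (1 : SymmetricAlgebra k W) ⊗ₜ[k] (CliffordAlgebra.ι _ w * x) =
          odd w * ((1 : SymmetricAlgebra k W) ⊗ₜ[k] x) := by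
        rw [odd_apply, Algebra.TensorProduct.tmul_mul_tmul, one_mul]
      exact this ▸ odd_mul w _ hx

/-- One step of the recursion defining the Koszul differential on `⋀ W`: it computes `d (w ∧ x)`
from `x` and `d x`. -/
def dStep : W →ₗ[k] ExteriorAlgebra k W × Koszul k W →ₗ[k] Koszul k W :=
  LinearMap.mk₂ k (fun w z => even w * (1 ⊗ₜ z.1) - odd w * z.2)
    (fun v w z => by simp only [map_add, add_mul]; abel)
    (fun c w z => by simp only [map_smul, smul_mul_assoc, smul_sub])
    (fun w y z => by simp only [Prod.fst_add, Prod.snd_add, TensorProduct.tmul_add, mul_add]; abel)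
    (fun c w z => by
      simp only [Prod.smul_fst, Prod.smul_snd, TensorProduct.tmul_smul, mul_smul_comm, smul_sub])

theorem even_mul_odd_mul (v w : W) (y : Koszul k W) :
    even v * (odd w * y) = odd w * (even v * y) := by
  rw [even_mul, even_mul, odd_mul_smul]

/-- The restriction of the Koszul differential to `⋀ W`. -/
def dExt : ExteriorAlgebra k W →ₗ[k] Koszul k W :=
  CliffordAlgebra.foldr' (0 : QuadraticForm k W) dStep (fun w x y => by
    have h : (1 : SymmetricAlgebra k W) ⊗ₜ[k] (CliffordAlgebra.ι (0 : QuadraticForm k W) w * x) =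
        odd w * ((1 : SymmetricAlgebra k W) ⊗ₜ[k] x) := by
      rw [odd_apply, Algebra.TensorProduct.tmul_mul_tmul, one_mul]
    simp only [dStep, LinearMap.mk₂_apply]
    rw [h, mul_sub, even_mul_odd_mul, ← mul_assoc (odd w) (odd w), odd_mul_self]
    simp) 0

/-- The Koszul differential: the `Sym W`-linear antiderivation with `1 ⊗ w ↦ w ⊗ 1`. -/
def d : Koszul k W →ₗ[SymmetricAlgebra k W] Koszul k W :=
  LinearMap.liftBaseChange (SymmetricAlgebra k W) dExt

theorem d_tmul (p : SymmetricAlgebra k W) (x : ExteriorAlgebra k W) :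
    d (p ⊗ₜ[k] x) = p • dExt x := by simp [d]

theorem d_one : d (1 : Koszul k W) = 0 := by
  rw [Algebra.TensorProduct.one_def, d_tmul]
  have := CliffordAlgebra.foldr'_algebraMap (0 : QuadraticForm k W) dStep
  simp only [dExt]
  rw [← map_one (algebraMap k (ExteriorAlgebra k W))]
  exact (congrArg _ (this _ 0 1)).trans (by simp)

theorem d_odd_mul (w : W) (y : Koszul k W) : d (odd w * y) = even w * y - odd w * d y := by
  induction y using TensorProduct.induction_on with
  | zero => simp
  | add x y hx hy => rw [mul_add, map_add, hx, hy, map_add, mul_add, mul_add]; abel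
  | tmul p x =>
    have : odd w * (p ⊗ₜ[k] x) = p ⊗ₜ[k] (CliffordAlgebra.ι (0 : QuadraticForm k W) w * x) := by
      rw [odd_apply, Algebra.TensorProduct.tmul_mul_tmul, one_mul]
    rw [this, d_tmul, d_tmul]
    have h2 : dExt (k := k) (CliffordAlgebra.ι (0 : QuadraticForm k W) w * x) =
        dStep w (x, dExt x) := CliffordAlgebra.foldr'_ι_mul _ _ _ _ _ _
    rw [h2, dStep, LinearMap.mk₂_apply, smul_sub, odd_mul_smul, ← smul_one_tmul p x, mul_smul_comm]

theorem d_d (y : Koszul k W) : d (d y) = 0 := by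
  induction y using induction with
  | one => rw [d_one, map_zero]
  | add x y hx hy => rw [map_add, map_add, hx, hy, add_zero]
  | smul p x hx => rw [map_smul, map_smul, hx, smul_zero]
  | odd_mul w x hx =>
    rw [d_odd_mul, map_sub, even_mul, map_smul, d_odd_mul, hx, even_mul]
    simp

/-- The augmentation `Sym W ⊗ ⋀ W → k`. -/
def aug : Koszul k W →ₐ[k] k :=
  Algebra.TensorProduct.lift SymmetricAlgebra.algebraMapInv ExteriorAlgebra.algebraMapInv
    fun _ _ => Commute.all _ _

theorem aug_tmul (p : SymmetricAlgebra k W) (x : ExteriorAlgebra k W) :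
    aug (p ⊗ₜ[k] x) = SymmetricAlgebra.algebraMapInv p * ExteriorAlgebra.algebraMapInv x := by
  simp [aug]

theorem aug_odd (w : W) : aug (odd (k := k) w) = 0 := by
  rw [odd_apply, aug_tmul, ExteriorAlgebra.algebraMapInv, ExteriorAlgebra.lift_ι_apply]
  simp

theorem aug_even (w : W) : aug (even (k := k) w) = 0 := by
  rw [even_apply, aug_tmul, SymmetricAlgebra.algebraMapInv_ι, zero_mul]

theorem aug_smul (p : SymmetricAlgebra k W) (y : Koszul k W) :
    aug (p • y) = SymmetricAlgebra.algebraMapInv p * aug y := by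
  rw [smul_eq_tmul_mul, map_mul, aug_tmul, map_one, mul_one]

theorem aug_d (y : Koszul k W) : aug (d y) = 0 := by
  induction y using induction with
  | one => rw [d_one, map_zero]
  | add x y hx hy => rw [map_add, map_add, hx, hy, add_zero]
  | smul p x hx => rw [map_smul, aug_smul, hx, mul_zero]
  | odd_mul w x hx =>
    rw [d_odd_mul, map_sub, map_mul, map_mul, aug_even, aug_odd, zero_mul, zero_mul, sub_zero]

/-! ### The exterior differential and the number operator -/

/-- The homomorphism `p ↦ p + ε dp` to the square zero extension of `Sym W` by the Koszul
algebra. -/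
def derivHom : SymmetricAlgebra k W →ₐ[k] TrivSqZeroExt (SymmetricAlgebra k W) (Koszul k W) :=
  SymmetricAlgebra.lift
    { toFun := fun w => TrivSqZeroExt.inl (SymmetricAlgebra.ι k W w) + TrivSqZeroExt.inr (odd w)
      map_add' := fun v w => by
        simp only [map_add, TrivSqZeroExt.inl_add, TrivSqZeroExt.inr_add]; abel
      map_smul' := fun c w => by
        simp only [map_smul, TrivSqZeroExt.inl_smul, TrivSqZeroExt.inr_smul, smul_add,
          RingHom.id_apply] }

theorem fst_derivHom (p : SymmetricAlgebra k W) : (derivHom p).fst = p := by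
  have : (TrivSqZeroExt.fstHom k (SymmetricAlgebra k W) (Koszul k W)).comp derivHom =
      AlgHom.id k _ := by
    refine SymmetricAlgebra.algHom_ext (LinearMap.ext fun w => ?_)
    simp [derivHom]
  exact DFunLike.congr_fun this p

/-- The universal derivation `Sym W → Sym W ⊗ W`, with `W` placed in `⋀ W`. -/
def deriv : SymmetricAlgebra k W →ₗ[k] Koszul k W where
  toFun p := (derivHom p).snd
  map_add' p q := by simp
  map_smul' c p := by simp

theorem deriv_ι (w : W) : deriv (SymmetricAlgebra.ι k W w) = odd w := by
  simp [deriv, derivHom]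

theorem deriv_mul (p q : SymmetricAlgebra k W) : deriv (p * q) = p • deriv q + q • deriv p := by
  simp [deriv, fst_derivHom]

theorem deriv_algebraMap (c : k) : deriv (algebraMap k (SymmetricAlgebra k W) c) = 0 := by
  change (derivHom (algebraMap k (SymmetricAlgebra k W) c)).snd = 0
  rw [AlgHom.commutes]
  rfl

theorem deriv_mul_odd (p : SymmetricAlgebra k W) (w : W) :
    deriv p * odd w = -(odd w * deriv p) := by
  induction p using SymmetricAlgebra.induction with
  | algebraMap r => simp [deriv_algebraMap]
  | ι v => rw [deriv_ι, eq_neg_iff_add_eq_zero, odd_mul_odd_add]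
  | mul a b ha hb =>
    rw [deriv_mul, add_mul, smul_mul_assoc, smul_mul_assoc, ha, hb, mul_add, odd_mul_smul,
      odd_mul_smul, smul_neg, smul_neg, neg_add]
  | add a b ha hb => rw [map_add, add_mul, ha, hb, mul_add, neg_add]

/-- The exterior differential `p ⊗ x ↦ dp ∧ x`. -/
def δ : Koszul k W →ₗ[k] Koszul k W :=
  TensorProduct.lift ((LinearMap.mul k (Koszul k W)).compl₁₂ deriv
    Algebra.TensorProduct.includeRight.toLinearMap)

theorem δ_tmul (p : SymmetricAlgebra k W) (x : ExteriorAlgebra k W) :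
    δ (p ⊗ₜ[k] x) = deriv p * (1 ⊗ₜ x) := by simp [δ]

theorem δ_one : δ (1 : Koszul k W) = 0 := by
  rw [Algebra.TensorProduct.one_def, δ_tmul, ← map_one (algebraMap k (SymmetricAlgebra k W)),
    deriv_algebraMap, zero_mul]

theorem δ_smul (p : SymmetricAlgebra k W) (y : Koszul k W) :
    δ (p • y) = p • δ y + deriv p * y := by
  induction y using TensorProduct.induction_on with
  | zero => simp
  | add x y hx hy => rw [smul_add, map_add, hx, hy, map_add, mul_add, smul_add]; abel
  | tmul q x =>
    rw [TensorProduct.smul_tmul', smul_eq_mul, δ_tmul, deriv_mul, δ_tmul, add_mul, smul_mul_assoc,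
      smul_mul_assoc, ← mul_smul_comm q, smul_one_tmul]

theorem δ_even_mul (w : W) (y : Koszul k W) : δ (even w * y) = even w * δ y + odd w * y := by
  rw [even_mul, δ_smul, deriv_ι, even_mul]

theorem δ_odd_mul (w : W) (y : Koszul k W) : δ (odd w * y) = -(odd w * δ y) := by
  induction y using TensorProduct.induction_on with
  | zero => simp
  | add x y hx hy => rw [mul_add, map_add, hx, hy, map_add, mul_add, neg_add]
  | tmul p x =>
    have h : odd w * (1 ⊗ₜ[k] x) = 1 ⊗ₜ[k] (ExteriorAlgebra.ι k w * x) := by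
      rw [odd_apply, Algebra.TensorProduct.tmul_mul_tmul, one_mul]
    rw [odd_apply, Algebra.TensorProduct.tmul_mul_tmul, one_mul, δ_tmul, δ_tmul, ← odd_apply, ← h,
      ← mul_assoc, ← mul_assoc, eq_neg_iff_add_eq_zero, ← add_mul, deriv_mul_odd, neg_add_cancel,
      zero_mul]

/-- The number operator `dδ + δd`; it multiplies a product of `m` even or odd generators by `m`. -/
def number : Module.End k (Koszul k W) :=
  (d.restrictScalars k) ∘ₗ δ + δ ∘ₗ (d.restrictScalars k)

theorem number_apply (y : Koszul k W) : number y = d (δ y) + δ (d y) := rfl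

theorem number_one : number (1 : Koszul k W) = 0 := by
  rw [number_apply, δ_one, d_one, map_zero, map_zero, add_zero]

theorem number_even_mul (w : W) (y : Koszul k W) :
    number (even w * y) = even w * number y + even w * y := by
  have h : ∀ z : Koszul k W, d (even w * z) = even w * d z := fun z => by
    rw [even_mul, map_smul, even_mul]
  rw [number_apply, number_apply, δ_even_mul, map_add, h, h, δ_even_mul, d_odd_mul, mul_add]
  abel

theorem number_odd_mul (w : W) (y : Koszul k W) :
    number (odd w * y) = odd w * number y + odd w * y := by
  rw [number_apply, number_apply, δ_odd_mul, d_odd_mul, map_neg, d_odd_mul, map_sub, δ_even_mul,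
    δ_odd_mul, mul_add]
  abel

theorem d_number (y : Koszul k W) : d (number y) = number (d y) := by
  rw [number_apply, number_apply, map_add, d_d, d_d, map_zero, add_zero, zero_add]

variable (k W) in
/-- The span of the eigenvectors of the number operator with eigenvalue at least `m`. -/
def eig (m : ℕ) : Submodule k (Koszul k W) :=
  Submodule.span k {z | ∃ a : ℕ, m ≤ a ∧ number z = (a : k) • z}

theorem eig_antitone {m n : ℕ} (h : m ≤ n) : eig k W n ≤ eig k W m :=
  Submodule.span_mono fun _ ⟨a, ha, hz⟩ => ⟨a, h.trans ha, hz⟩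

theorem one_mem_eig : (1 : Koszul k W) ∈ eig k W 0 :=
  Submodule.subset_span ⟨0, le_rfl, by simp [number_one]⟩

theorem even_mul_mem_eig {m : ℕ} (w : W) {y : Koszul k W} (hy : y ∈ eig k W m) :
    even w * y ∈ eig k W (m + 1) := by
  refine (Submodule.map_span_le (LinearMap.mulLeft k (even w)) _ (eig k W (m + 1))).2 ?_
    ⟨y, hy, rfl⟩
  rintro z ⟨a, ha, hz⟩
  refine Submodule.subset_span ⟨a + 1, by omega, ?_⟩
  rw [LinearMap.mulLeft_apply, number_even_mul, hz, mul_smul_comm]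
  push_cast
  rw [add_smul, one_smul]

theorem odd_mul_mem_eig {m : ℕ} (w : W) {y : Koszul k W} (hy : y ∈ eig k W m) :
    odd w * y ∈ eig k W (m + 1) := by
  refine (Submodule.map_span_le (LinearMap.mulLeft k (odd w)) _ (eig k W (m + 1))).2 ?_
    ⟨y, hy, rfl⟩
  rintro z ⟨a, ha, hz⟩
  refine Submodule.subset_span ⟨a + 1, by omega, ?_⟩
  rw [LinearMap.mulLeft_apply, number_odd_mul, hz, mul_smul_comm]
  push_cast
  rw [add_smul, one_smul]

theorem smul_mem_eig {m : ℕ} (p : SymmetricAlgebra k W) {y : Koszul k W} (hy : y ∈ eig k W m) :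
    p • y ∈ eig k W m := by
  induction p using SymmetricAlgebra.induction generalizing y with
  | algebraMap r => rw [algebraMap_smul]; exact Submodule.smul_mem _ _ hy
  | ι w => rw [← even_mul]; exact eig_antitone (Nat.le_succ m) (even_mul_mem_eig w hy)
  | mul a b ha hb => rw [mul_smul]; exact ha (hb hy)
  | add a b ha hb => rw [add_smul]; exact Submodule.add_mem _ (ha hy) (hb hy)

/-- A sum of eigenvectors of the number operator with positive eigenvalues is annihilated by a
polynomial in the number operator whose constant term is not zero. -/
theorem exists_aeval_number_eq_zero [CharZero k] {z : Koszul k W} (hz : z ∈ eig k W 1) :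
    ∃ q : Polynomial k, q.coeff 0 ≠ 0 ∧ Polynomial.aeval number q z = 0 := by
  induction hz using Submodule.span_induction with
  | mem z hz =>
    obtain ⟨a, ha, hz⟩ := hz
    refine ⟨Polynomial.X - Polynomial.C (a : k), ?_, ?_⟩
    · have : (a : k) ≠ 0 := by exact_mod_cast (by omega : a ≠ 0)
      simpa using this
    · rw [map_sub, Polynomial.aeval_X, Polynomial.aeval_C, LinearMap.sub_apply, hz,
        Module.algebraMap_end_apply, sub_self]
  | zero => exact ⟨1, by simp, by simp⟩
  | add x y _ _ hx hy =>
    obtain ⟨p, hp, hpx⟩ := hx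
    obtain ⟨q, hq, hqy⟩ := hy
    refine ⟨p * q, by simp [Polynomial.mul_coeff_zero, hp, hq], ?_⟩
    rw [map_add]
    nth_rewrite 1 [mul_comm p q]
    rw [map_mul, map_mul, Module.End.mul_apply, Module.End.mul_apply, hpx, hqy, map_zero, map_zero,
      add_zero]
  | smul c x _ hx =>
    obtain ⟨p, hp, hpx⟩ := hx
    exact ⟨p, hp, by rw [map_smul, hpx, smul_zero]⟩

theorem d_aeval_number (q : Polynomial k) (z : Koszul k W) :
    d (Polynomial.aeval number q z) = Polynomial.aeval number q (d z) := by
  induction q using Polynomial.induction_on' with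
  | add p q hp hq => simp [hp, hq]
  | monomial n a =>
    simp only [Polynomial.aeval_monomial, Module.End.mul_apply, Module.algebraMap_end_apply]
    have : ∀ z : Koszul k W, d ((number ^ n) z) = (number ^ n) (d z) := by
      induction n with
      | zero => intro z; simp
      | succ n ih =>
        intro z
        rw [pow_succ, Module.End.mul_apply, ih, d_number, Module.End.mul_apply]
    rw [LinearMap.map_smul_of_tower, this]

/-! ### The graded pieces and their exactness -/

variable (k W) in
/-- The piece `Sym W ⊗ ⋀ⁿ W` of the Koszul algebra, as a submodule. -/
def piece (n : ℕ) : Submodule (SymmetricAlgebra k W) (Koszul k W) :=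
  (⋀[k]^n W).baseChange (SymmetricAlgebra k W)

theorem tmul_mem_piece {n : ℕ} (p : SymmetricAlgebra k W) {x : ExteriorAlgebra k W}
    (hx : x ∈ ⋀[k]^n W) : p ⊗ₜ[k] x ∈ piece k W n :=
  Submodule.tmul_mem_baseChange_of_mem p hx

theorem piece_le {n : ℕ} {N : Submodule (SymmetricAlgebra k W) (Koszul k W)}
    (h : ∀ x ∈ ⋀[k]^n W, (1 : SymmetricAlgebra k W) ⊗ₜ[k] x ∈ N) : piece k W n ≤ N := by
  rw [piece, Submodule.baseChange_eq_span, Submodule.span_le]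
  rintro _ ⟨x, hx, rfl⟩
  exact h x hx

theorem one_mem_piece : (1 : Koszul k W) ∈ piece k W 0 :=
  tmul_mem_piece 1 (by simp)

theorem odd_mul_mem_piece {n : ℕ} (w : W) {y : Koszul k W} (hy : y ∈ piece k W n) :
    odd w * y ∈ piece k W (n + 1) := by
  suffices piece k W n ≤ (piece k W (n + 1)).comap
      (LinearMap.mulLeft (SymmetricAlgebra k W) (odd w : Koszul k W)) from this hy
  refine piece_le fun x hx => ?_
  change odd w * ((1 : SymmetricAlgebra k W) ⊗ₜ[k] x) ∈ piece k W (n + 1)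
  rw [odd_apply, Algebra.TensorProduct.tmul_mul_tmul, one_mul]
  refine tmul_mem_piece _ ?_
  rw [ExteriorAlgebra.exteriorPower, pow_succ']
  exact Submodule.mul_mem_mul ⟨w, rfl⟩ hx

/-- A submodule contains the piece of degree `n + 1` if it contains the products of odd generators
with the piece of degree `n`. -/
theorem piece_succ_le {n : ℕ} {N : Submodule (SymmetricAlgebra k W) (Koszul k W)}
    (h : ∀ w, ∀ y ∈ piece k W n, odd w * y ∈ N) : piece k W (n + 1) ≤ N := by
  refine piece_le fun x hx => ?_
  rw [ExteriorAlgebra.exteriorPower, pow_succ'] at hx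
  induction hx using Submodule.mul_induction_on' with
  | mem_mul_mem a ha b hb =>
    obtain ⟨w, rfl⟩ := ha
    have := h w _ (tmul_mem_piece 1 hb)
    rwa [odd_apply, Algebra.TensorProduct.tmul_mul_tmul, one_mul] at this
  | add x _ y _ hx hy => rw [TensorProduct.tmul_add]; exact N.add_mem hx hy

theorem piece_zero_le {N : Submodule (SymmetricAlgebra k W) (Koszul k W)} (h : 1 ∈ N) :
    piece k W 0 ≤ N := by
  refine piece_le fun x hx => ?_
  rw [ExteriorAlgebra.exteriorPower, pow_zero, Submodule.mem_one] at hx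
  obtain ⟨c, rfl⟩ := hx
  rw [Algebra.algebraMap_eq_smul_one, TensorProduct.tmul_smul]
  have := N.smul_mem (algebraMap k (SymmetricAlgebra k W) c) h
  rwa [algebraMap_smul] at this

theorem d_piece_zero {y : Koszul k W} (hy : y ∈ piece k W 0) : d y = 0 := by
  have : piece k W 0 ≤ LinearMap.ker d := piece_zero_le (by rw [LinearMap.mem_ker, d_one])
  exact this hy

theorem d_mem_piece {n : ℕ} {y : Koszul k W} (hy : y ∈ piece k W (n + 1)) :
    d y ∈ piece k W n := by
  suffices piece k W (n + 1) ≤ (piece k W n).comap d from this hy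
  induction n generalizing y with
  | zero =>
    refine piece_succ_le fun w y hy => ?_
    rw [Submodule.mem_comap, d_odd_mul, d_piece_zero hy, mul_zero, sub_zero, even_mul]
    exact Submodule.smul_mem _ _ hy
  | succ n ih =>
    refine piece_succ_le fun w y hy => ?_
    rw [Submodule.mem_comap, d_odd_mul, even_mul]
    exact Submodule.sub_mem _ (Submodule.smul_mem _ _ hy) (odd_mul_mem_piece w (ih hy hy))

theorem deriv_mul_mem_piece {n : ℕ} (p : SymmetricAlgebra k W) {y : Koszul k W}
    (hy : y ∈ piece k W n) : deriv p * y ∈ piece k W (n + 1) := by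
  induction p using SymmetricAlgebra.induction with
  | algebraMap r => rw [deriv_algebraMap, zero_mul]; exact Submodule.zero_mem _
  | ι w => rw [deriv_ι]; exact odd_mul_mem_piece w hy
  | mul a b ha hb =>
    rw [deriv_mul, add_mul, smul_mul_assoc, smul_mul_assoc]
    exact Submodule.add_mem _ (Submodule.smul_mem _ _ hb) (Submodule.smul_mem _ _ ha)
  | add a b ha hb => rw [map_add, add_mul]; exact Submodule.add_mem _ ha hb

theorem δ_mem_piece {n : ℕ} {y : Koszul k W} (hy : y ∈ piece k W n) :
    δ y ∈ piece k W (n + 1) := by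
  rw [piece, Submodule.baseChange_eq_span] at hy
  induction hy using Submodule.span_induction with
  | mem z hz =>
    obtain ⟨x, hx, rfl⟩ := hz
    rw [TensorProduct.mk_apply, δ_tmul]
    exact deriv_mul_mem_piece 1 (tmul_mem_piece 1 hx)
  | zero => rw [map_zero]; exact Submodule.zero_mem _
  | add x y _ _ hx hy => rw [map_add]; exact Submodule.add_mem _ hx hy
  | smul p x hx' hx =>
    rw [δ_smul]
    refine Submodule.add_mem _ (Submodule.smul_mem _ _ hx) (deriv_mul_mem_piece p ?_)
    rwa [piece, Submodule.baseChange_eq_span]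

theorem number_mem_piece {n : ℕ} {y : Koszul k W} (hy : y ∈ piece k W n) :
    number y ∈ piece k W n := by
  refine Submodule.add_mem _ (d_mem_piece (δ_mem_piece hy)) ?_
  change δ (d y) ∈ _
  cases n with
  | zero => rw [d_piece_zero hy, map_zero]; exact Submodule.zero_mem _
  | succ n => exact δ_mem_piece (d_mem_piece hy)

theorem aeval_number_mem_piece {n : ℕ} (q : Polynomial k) {y : Koszul k W}
    (hy : y ∈ piece k W n) : Polynomial.aeval number q y ∈ piece k W n := by
  induction q using Polynomial.induction_on' with
  | add p q hp hq => rw [map_add]; exact Submodule.add_mem _ hp hq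
  | monomial m a =>
    simp only [Polynomial.aeval_monomial, Module.End.mul_apply, Module.algebraMap_end_apply]
    refine Submodule.smul_of_tower_mem _ _ ?_
    induction m with
    | zero => simpa using hy
    | succ m ih => rw [pow_succ', Module.End.mul_apply]; exact number_mem_piece ih

variable (k W) in
/-- `eig` as a module over the symmetric algebra. -/
def eigSubmodule (m : ℕ) : Submodule (SymmetricAlgebra k W) (Koszul k W) :=
  { (eig k W m).toAddSubmonoid with smul_mem' := fun p _ hy => smul_mem_eig p hy }

theorem piece_le_eig (n : ℕ) : piece k W n ≤ eigSubmodule k W n := by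
  induction n with
  | zero => exact piece_zero_le one_mem_eig
  | succ n ih => exact piece_succ_le fun w y hy => odd_mul_mem_eig w (ih hy)

/-- Modulo constants, polynomials are sums of eigenvectors of the number operator with positive
eigenvalue. -/
theorem sub_aug_mem_eig {y : Koszul k W} (hy : y ∈ piece k W 0) :
    y - aug y • 1 ∈ eig k W 1 := by
  have key : ∀ p : SymmetricAlgebra k W,
      p • (1 : Koszul k W) - SymmetricAlgebra.algebraMapInv p • 1 ∈ eig k W 1 := by
    intro p
    induction p using SymmetricAlgebra.induction with
    | algebraMap r => simp
    | ι w =>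
      rw [SymmetricAlgebra.algebraMapInv_ι, zero_smul, sub_zero, ← even_mul]
      exact even_mul_mem_eig w one_mem_eig
    | mul a b ha hb =>
      have := Submodule.add_mem _ (smul_mem_eig a hb)
        (Submodule.smul_mem _ (SymmetricAlgebra.algebraMapInv b) ha)
      convert this using 1
      rw [map_mul, smul_sub, mul_smul, smul_sub, smul_comm a (SymmetricAlgebra.algebraMapInv b),
        smul_smul (SymmetricAlgebra.algebraMapInv b), mul_comm (SymmetricAlgebra.algebraMapInv a)]
      abel
    | add a b ha hb =>
      have := Submodule.add_mem _ ha hb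
      convert this using 1
      rw [map_add, add_smul, add_smul]
      abel
  have hle : piece k W 0 ≤ Submodule.span (SymmetricAlgebra k W) {1} :=
    piece_zero_le (Submodule.mem_span_singleton_self 1)
  obtain ⟨p, rfl⟩ := Submodule.mem_span_singleton.1 (hle hy)
  rw [aug_smul, map_one, mul_one]
  exact key p

/-- A cycle of the Koszul complex in the span of the eigenvectors with positive eigenvalue is a
boundary: `δ` is a contracting homotopy up to the invertible action of the number operator. -/
theorem exists_d_eq_of_mem_eig [CharZero k] {n : ℕ} {z : Koszul k W} (hz : z ∈ piece k W n)
    (hd : d z = 0) (he : z ∈ eig k W 1) : ∃ y ∈ piece k W (n + 1), d y = z := by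
  obtain ⟨q, hq, hqz⟩ := exists_aeval_number_eq_zero he
  -- Write `q = X r + c` with `c ≠ 0`; on cycles the number operator is `dδ`, so
  -- `-c z = d (δ (r z))`.
  rw [← Polynomial.X_mul_divX_add q, map_add, map_mul, Polynomial.aeval_X, Polynomial.aeval_C,
    LinearMap.add_apply, Module.End.mul_apply, Module.algebraMap_end_apply, number_apply,
    d_aeval_number, hd, map_zero, map_zero, add_zero] at hqz
  set r := Polynomial.aeval number q.divX z with hr
  have hrm : r ∈ piece k W n := aeval_number_mem_piece _ hz
  refine ⟨-((q.coeff 0)⁻¹ • δ r), Submodule.neg_mem _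
    (Submodule.smul_of_tower_mem _ _ (δ_mem_piece hrm)), ?_⟩
  rw [map_neg, LinearMap.map_smul_of_tower, eq_neg_of_add_eq_zero_left hqz, smul_neg, neg_neg,
    smul_smul, inv_mul_cancel₀ hq, one_smul]

theorem exact_succ [CharZero k] {n : ℕ} {z : Koszul k W} (hz : z ∈ piece k W (n + 1))
    (hd : d z = 0) : ∃ y ∈ piece k W (n + 2), d y = z :=
  exists_d_eq_of_mem_eig hz hd (eig_antitone (by omega) (piece_le_eig (n + 1) hz))

theorem exact_zero [CharZero k] {z : Koszul k W} (hz : z ∈ piece k W 0) (ha : aug z = 0) :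
    ∃ y ∈ piece k W 1, d y = z := by
  refine exists_d_eq_of_mem_eig hz (d_piece_zero hz) ?_
  have := sub_aug_mem_eig hz
  rwa [ha, zero_smul, sub_zero] at this

instance projective_piece (n : ℕ) : Module.Projective (SymmetricAlgebra k W) (piece k W n) := by
  have hinj : Function.Injective ((⋀[k]^n W).subtype.baseChange (SymmetricAlgebra k W)) :=
    Module.Flat.lTensor_preserves_injective_linearMap _ (Submodule.subtype_injective _)
  exact Module.Projective.of_equiv (LinearEquiv.ofInjective _ hinj)

/-! ### Functoriality of the Koszul algebra -/

variable {W' : Type u} [AddCommGroup W'] [Module k W']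

/-- The homomorphism of symmetric algebras induced by a linear map. -/
def symMap (g : W →ₗ[k] W') : SymmetricAlgebra k W →ₐ[k] SymmetricAlgebra k W' :=
  SymmetricAlgebra.lift (SymmetricAlgebra.ι k W' ∘ₗ g)

/-- The homomorphism of Koszul algebras induced by a linear map. -/
def map (g : W →ₗ[k] W') : Koszul k W →ₐ[k] Koszul k W' :=
  Algebra.TensorProduct.map (symMap g) (ExteriorAlgebra.map g)

theorem map_tmul (g : W →ₗ[k] W') (p : SymmetricAlgebra k W) (x : ExteriorAlgebra k W) :
    map g (p ⊗ₜ[k] x) = symMap g p ⊗ₜ[k] ExteriorAlgebra.map g x := rfl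

theorem symMap_ι (g : W →ₗ[k] W') (w : W) :
    symMap g (SymmetricAlgebra.ι k W w) = SymmetricAlgebra.ι k W' (g w) := by
  simp [symMap]

theorem map_even (g : W →ₗ[k] W') (w : W) : map g (even w) = even (g w) := by
  rw [even_apply, map_tmul, symMap_ι, map_one, even_apply]

theorem map_odd (g : W →ₗ[k] W') (w : W) : map g (odd w) = odd (g w) := by
  rw [odd_apply, map_tmul, map_one, ExteriorAlgebra.map_apply_ι, odd_apply]

theorem map_smul' (g : W →ₗ[k] W') (p : SymmetricAlgebra k W) (y : Koszul k W) :
    map g (p • y) = symMap g p • map g y := by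
  rw [smul_eq_tmul_mul, map_mul, map_tmul, map_one, smul_eq_tmul_mul]

theorem map_d (g : W →ₗ[k] W') (y : Koszul k W) : map g (d y) = d (map g y) := by
  induction y using induction with
  | one => rw [d_one, map_zero, map_one, d_one]
  | add x y hx hy => rw [map_add, map_add, hx, hy, map_add, map_add]
  | smul p x hx => rw [map_smul, map_smul', hx, map_smul', map_smul]
  | odd_mul w x hx =>
    rw [d_odd_mul, map_sub, map_mul, map_mul, hx, map_mul, map_odd, map_even, d_odd_mul]

theorem aug_map (g : W →ₗ[k] W') (y : Koszul k W) : aug (map g y) = aug y := by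
  have h : ∀ p : SymmetricAlgebra k W, SymmetricAlgebra.algebraMapInv (symMap g p) =
      SymmetricAlgebra.algebraMapInv p := fun p => by
    have : SymmetricAlgebra.algebraMapInv.comp (symMap g) =
        (SymmetricAlgebra.algebraMapInv : SymmetricAlgebra k W →ₐ[k] k) := by
      refine SymmetricAlgebra.algHom_ext (LinearMap.ext fun w => ?_)
      exact (congrArg _ (symMap_ι g w)).trans ((SymmetricAlgebra.algebraMapInv_ι _).trans
        (SymmetricAlgebra.algebraMapInv_ι w).symm)
    exact DFunLike.congr_fun this p
  induction y using induction with
  | one => simp only [map_one]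
  | add x y hx hy => rw [map_add, map_add, hx, hy, map_add]
  | smul p x hx => rw [map_smul', aug_smul, aug_smul, hx, h]
  | odd_mul w x hx => rw [map_mul, map_mul, map_mul, map_odd, aug_odd, aug_odd, zero_mul, zero_mul]

theorem map_mem_piece (g : W →ₗ[k] W') {n : ℕ} {y : Koszul k W} (hy : y ∈ piece k W n) :
    map g y ∈ piece k W' n := by
  rw [piece, Submodule.baseChange_eq_span] at hy
  induction hy using Submodule.span_induction with
  | mem z hz =>
    obtain ⟨x, hx, rfl⟩ := hz
    rw [TensorProduct.mk_apply, map_tmul]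
    refine tmul_mem_piece _ ?_
    have h := Submodule.mem_map_of_mem (f := (ExteriorAlgebra.map g).toLinearMap) hx
    rw [ExteriorAlgebra.exteriorPower, Submodule.map_pow, ExteriorAlgebra.ι_range_map_map] at h
    exact pow_le_pow_left' (LinearMap.map_le_range) n h
  | zero => rw [map_zero]; exact Submodule.zero_mem _
  | add x y _ _ hx hy => rw [map_add]; exact Submodule.add_mem _ hx hy
  | smul p x _ hx => rw [map_smul']; exact Submodule.smul_mem _ _ hx

theorem symMap_id : symMap (LinearMap.id : W →ₗ[k] W) = AlgHom.id k _ :=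
  SymmetricAlgebra.algHom_ext (LinearMap.ext fun w => symMap_ι _ w)

theorem symMap_comp {W'' : Type u} [AddCommGroup W''] [Module k W''] (h : W' →ₗ[k] W'')
    (g : W →ₗ[k] W') : symMap (h ∘ₗ g) = (symMap h).comp (symMap g) := by
  refine SymmetricAlgebra.algHom_ext (LinearMap.ext fun w => ?_)
  refine (symMap_ι (h ∘ₗ g) w).trans ?_
  exact ((congrArg (symMap h) (symMap_ι g w)).trans (symMap_ι h (g w))).symm

theorem map_id : map (LinearMap.id : W →ₗ[k] W) = AlgHom.id k _ := by
  rw [map, symMap_id, ExteriorAlgebra.map_id, Algebra.TensorProduct.map_id]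

theorem map_comp {W'' : Type u} [AddCommGroup W''] [Module k W''] (h : W' →ₗ[k] W'')
    (g : W →ₗ[k] W') : map (h ∘ₗ g) = (map h).comp (map g) := by
  rw [map, map, map, symMap_comp, ← ExteriorAlgebra.map_comp_map, Algebra.TensorProduct.map_comp]

/-! ### Spanning the graded pieces by tensor powers -/

/-- The map `W^{⊗ (m + p)} → Sym W ⊗ ⋀ W` that sends a pure tensor to the product of its first `m`
factors in `Sym W` and its last `p` factors in `⋀ W`. -/
def ofTensorPower (m p : ℕ) : (⨂[k] _ : Fin (m + p), W) →ₗ[k] Koszul k W :=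
  TensorProduct.map
    (PiTensorProduct.lift ((MultilinearMap.mkPiAlgebra k (Fin m) (SymmetricAlgebra k W)).compLinearMap
      fun _ => SymmetricAlgebra.ι k W))
    (PiTensorProduct.lift (ExteriorAlgebra.ιMulti k p (M := W)).toMultilinearMap) ∘ₗ
  (TensorPower.mulEquiv (R := k) (M := W) (n := m) (m := p)).symm.toLinearMap

theorem ofTensorPower_tprod_append (m p : ℕ) (a : Fin m → W) (b : Fin p → W) :
    ofTensorPower m p (PiTensorProduct.tprod k (Fin.append a b)) =
      (∏ i, SymmetricAlgebra.ι k W (a i)) ⊗ₜ[k] ExteriorAlgebra.ιMulti k p b := by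
  rw [ofTensorPower, ← TensorPower.tprod_mul_tprod, TensorPower.gMul_def, LinearMap.comp_apply,
    LinearEquiv.coe_coe, LinearEquiv.symm_apply_apply, TensorProduct.map_tmul,
    PiTensorProduct.lift.tprod, PiTensorProduct.lift.tprod]
  rfl

theorem ofTensorPower_mem_piece (m p : ℕ) (t : ⨂[k] _ : Fin (m + p), W) :
    ofTensorPower m p t ∈ piece k W p := by
  induction t using PiTensorProduct.induction_on with
  | smul_tprod r f =>
    rw [map_smul, ← Fin.append_castAdd_natAdd (f := f), ofTensorPower_tprod_append]
    exact Submodule.smul_of_tower_mem _ _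
      (tmul_mem_piece _ (ExteriorAlgebra.ιMulti_range k p ⟨_, rfl⟩))
  | add x y hx hy => rw [map_add]; exact Submodule.add_mem _ hx hy

theorem ofTensorPower_map (g : W →ₗ[k] W') (m p : ℕ) (t : ⨂[k] _ : Fin (m + p), W) :
    ofTensorPower m p (PiTensorProduct.map (fun _ => g) t) = map g (ofTensorPower m p t) := by
  induction t using PiTensorProduct.induction_on with
  | smul_tprod r f =>
    have h : (fun i => g (Fin.append (fun i => f (Fin.castAdd p i)) (fun i => f (Fin.natAdd m i)) i)) =
        Fin.append (fun i => g (f (Fin.castAdd p i))) (fun i => g (f (Fin.natAdd m i))) := by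
      funext i
      refine Fin.addCases (fun i => ?_) (fun i => ?_) i
      · simp only [Fin.append_left]
      · simp only [Fin.append_right]
    rw [map_smul, map_smul, map_smul, map_smul (map g), ← Fin.append_castAdd_natAdd (f := f),
      PiTensorProduct.map_tprod, h, ofTensorPower_tprod_append, ofTensorPower_tprod_append, map_tmul,
      map_prod, ExteriorAlgebra.map_apply_ιMulti]
    simp only [symMap_ι]
    rfl
  | add x y hx hy => simp only [map_add, hx, hy]

/-- The polynomials are spanned by products of vectors. -/
theorem mem_span_prod_ι (q : SymmetricAlgebra k W) : q ∈ Submodule.span k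
    {z | ∃ (m : ℕ) (a : Fin m → W), z = ∏ i, SymmetricAlgebra.ι k W (a i)} := by
  induction q using SymmetricAlgebra.induction with
  | algebraMap r =>
    rw [Algebra.algebraMap_eq_smul_one]
    exact Submodule.smul_mem _ _ (Submodule.subset_span ⟨0, Fin.elim0, by simp⟩)
  | ι w => exact Submodule.subset_span ⟨1, fun _ => w, by simp⟩
  | mul a b ha hb =>
    have h := Submodule.mul_mem_mul ha hb
    rw [Submodule.span_mul_span] at h
    refine Submodule.span_mono ?_ h
    rintro _ ⟨_, ⟨m, a, rfl⟩, _, ⟨n, b, rfl⟩, rfl⟩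
    refine ⟨m + n, Fin.append a b, ?_⟩
    simp [Fin.prod_univ_add]
  | add a b ha hb => exact Submodule.add_mem _ ha hb

/-- The maps `ofTensorPower m p` with fixed `p` jointly span the piece `Sym W ⊗ ⋀ᵖ W`. -/
theorem mem_iSup_range_ofTensorPower (p : ℕ) {y : Koszul k W} (hy : y ∈ piece k W p) :
    y ∈ ⨆ m, LinearMap.range (ofTensorPower (k := k) (W := W) m p) := by
  have key : ∀ (q : SymmetricAlgebra k W), ∀ x ∈ ⋀[k]^p W,
      q ⊗ₜ[k] x ∈ ⨆ m, LinearMap.range (ofTensorPower (k := k) (W := W) m p) := by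
    intro q x hx
    rw [← ExteriorAlgebra.ιMulti_span_fixedDegree] at hx
    have h := Submodule.apply_mem_map₂ (TensorProduct.mk k _ _) (mem_span_prod_ι q) hx
    rw [Submodule.map₂_span_span] at h
    refine Submodule.span_le.2 ?_ h
    rintro _ ⟨_, ⟨m, a, rfl⟩, _, ⟨b, rfl⟩, rfl⟩
    exact Submodule.mem_iSup_of_mem m ⟨_, ofTensorPower_tprod_append m p a b⟩
  obtain ⟨t, rfl⟩ := hy
  induction t using TensorProduct.induction_on with
  | zero => rw [map_zero]; exact Submodule.zero_mem _
  | tmul q x => exact key q x.1 x.2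
  | add x y hx hy => rw [map_add]; exact Submodule.add_mem _ hx hy

end Koszul

end Koszul

/-! ### Computing `Tor` from an arbitrary projective resolution -/

namespace AugAlg

/-- A resolution of `ℂ` by projective `P`-modules. -/
structure Resolution (D : AugAlg.{u}) where
  K : ChainComplex (ModuleCat.{u} D.P) ℕ
  e : K.X 0 ⟶ D.modC
  projective : ∀ n, Projective (K.X n)
  isResolution : IsResolution K e

namespace Resolution

attribute [instance] Resolution.projective

variable {D E : AugAlg.{u}} (r : Resolution D) (s : Resolution E)

theorem exists_to :
    ∃ k : (projectiveResolution D.modC).complex ⟶ r.K,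
      k.f 0 ≫ r.e = augmentation (projectiveResolution D.modC) ≫ 𝟙 _ :=
  exists_lift (isResolution_augmentation (projectiveResolution D.modC)).zero r.isResolution (𝟙 _)

theorem exists_from :
    ∃ k : r.K ⟶ (projectiveResolution D.modC).complex,
      k.f 0 ≫ augmentation (projectiveResolution D.modC) = r.e ≫ 𝟙 _ :=
  exists_lift r.isResolution.zero (isResolution_augmentation (projectiveResolution D.modC)) (𝟙 _)

/-- The comparison map from the chosen projective resolution of `ℂ`. -/
def comparison : (projectiveResolution D.modC).complex ⟶ r.K := r.exists_to.choose

theorem comparison_e :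
    r.comparison.f 0 ≫ r.e = augmentation (projectiveResolution D.modC) := by
  rw [comparison, r.exists_to.choose_spec, Category.comp_id]

/-- The homology of `R ⊗_P K` for a projective resolution `K` of `ℂ` is that for the chosen one. -/
def homologyIso (p : ℕ) :
    ((D.tensorR.mapHomologicalComplex (ComplexShape.down ℕ)).obj
      (projectiveResolution D.modC).complex).homology p ≅
    ((D.tensorR.mapHomologicalComplex (ComplexShape.down ℕ)).obj r.K).homology p where
  hom := HomologicalComplex.homologyMap ((D.tensorR.mapHomologicalComplex _).map r.comparison) p
  inv := HomologicalComplex.homologyMap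
    ((D.tensorR.mapHomologicalComplex _).map r.exists_from.choose) p
  hom_inv_id := by
    obtain ⟨h⟩ := lift_homotopy (isResolution_augmentation (projectiveResolution D.modC))
      (r.comparison ≫ r.exists_from.choose) (𝟙 _) (by
        rw [HomologicalComplex.comp_f, Category.assoc, r.exists_from.choose_spec, Category.comp_id,
          comparison_e, HomologicalComplex.id_f, Category.id_comp])
    rw [← HomologicalComplex.homologyMap_comp, ← Functor.map_comp,
      (D.tensorR.mapHomotopy h).homologyMap_eq, CategoryTheory.Functor.map_id,
      HomologicalComplex.homologyMap_id]
  inv_hom_id := by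
    obtain ⟨h⟩ := lift_homotopy r.isResolution
      (r.exists_from.choose ≫ r.comparison) (𝟙 _) (by
        rw [HomologicalComplex.comp_f, Category.assoc, comparison_e, r.exists_from.choose_spec,
          Category.comp_id, HomologicalComplex.id_f, Category.id_comp])
    rw [← HomologicalComplex.homologyMap_comp, ← Functor.map_comp,
      (D.tensorR.mapHomotopy h).homologyMap_eq, CategoryTheory.Functor.map_id,
      HomologicalComplex.homologyMap_id]

/-- `Tor_p^P(R, ℂ)` is the homology of `R ⊗_P K` for any projective resolution `K` of `ℂ`. -/
def torIso (p : ℕ) : D.tor p ≅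
    ((D.tensorR.mapHomologicalComplex (ComplexShape.down ℕ)).obj r.K).homology p :=
  D.torIso p ≪≫ r.homologyIso p

/-- The change-of-rings map may be computed from any map of projective resolutions of `ℂ`. -/
theorem torMap_comp_torIso (p : ℕ) (f : D ⟶ E)
    (κ : r.K ⟶ ((res f).mapHomologicalComplex _).obj s.K)
    (hκ : κ.f 0 ≫ (res f).map s.e = r.e ≫ modCMap f) :
    torMap p f ≫ (s.torIso p).hom =
      (r.torIso p).hom ≫ HomologicalComplex.homologyMap (tensorChain f κ) p := by
  obtain ⟨k, hk⟩ := exists_chain f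
  obtain ⟨h⟩ := lift_homotopy (s.isResolution.map (res f))
    (k ≫ ((res f).mapHomologicalComplex _).map s.comparison) (r.comparison ≫ κ) (by
      refine (Category.assoc (k.f 0) ((res f).map (s.comparison.f 0)) ((res f).map s.e)).trans ?_
      refine Eq.trans ?_ (Category.assoc (r.comparison.f 0) (κ.f 0) ((res f).map s.e)).symm
      refine (congrArg (k.f 0 ≫ ·) (((res f).map_comp _ _).symm.trans
        (congrArg (res f).map s.comparison_e))).trans (hk.trans ?_)
      rw [hκ, ← Category.assoc, comparison_e])
  have h1 : tensorChain f k ≫ (E.tensorR.mapHomologicalComplex _).map s.comparison =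
      tensorChain f (k ≫ ((res f).mapHomologicalComplex _).map s.comparison) := by
    ext1 i
    exact tensor_ext fun _ _ => rfl
  have h2 : (D.tensorR.mapHomologicalComplex _).map r.comparison ≫ tensorChain f κ =
      tensorChain f (r.comparison ≫ κ) := by
    ext1 i
    exact tensor_ext fun _ _ => rfl
  rw [torMap_eq p f k hk, torIso, torIso, Iso.trans_hom, Iso.trans_hom, Category.assoc,
    Category.assoc, Iso.inv_hom_id_assoc, Category.assoc]
  congr 1
  change _ ≫ HomologicalComplex.homologyMap _ p = HomologicalComplex.homologyMap _ p ≫ _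
  rw [← HomologicalComplex.homologyMap_comp, ← HomologicalComplex.homologyMap_comp, h1, h2,
    tensorChain_eq, tensorChain_eq f (r.comparison ≫ κ), HomologicalComplex.homologyMap_comp,
    HomologicalComplex.homologyMap_comp, (D.tensorR.mapHomotopy h).homologyMap_eq]

end Resolution

variable (D : AugAlg.{u}) {E : AugAlg.{u}}

/-- The unit of `R`, as an element of the `P`-module `R`. -/
def oneR : D.modR := (1 : D.R)

/-- The map `M → R ⊗_P M`, `m ↦ 1 ⊗ m`. -/
def unitMap (M : ModuleCat.{u} D.P) : D.toVec.obj M ⟶ D.tensorR.obj M :=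
  ModuleCat.ofHom (X := D.toVec.obj M) (Y := D.tensorR.obj M)
    { toFun := fun m => D.oneR ⊗ₜ[D.P] (show M from m)
      map_add' := fun _ _ => TensorProduct.tmul_add _ _ _
      map_smul' := fun c m => TensorProduct.tmul_smul (algebraMap ℂ D.P c) D.oneR (show M from m) }

theorem unitMap_surjective (hρ : Function.Surjective D.ρ) (M : ModuleCat.{u} D.P) :
    Function.Surjective (D.unitMap M).hom := by
  intro t
  refine TensorProduct.induction_on
    (motive := fun t : D.modR ⊗[D.P] M => ∃ m, (D.unitMap M).hom m = t) t ?_ ?_ ?_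
  · exact ⟨0, map_zero _⟩
  · intro x m
    obtain ⟨a, rfl⟩ := hρ x
    refine ⟨(a • m : M), ?_⟩
    have h : a • D.oneR = (show D.modR from D.ρ a) := mul_one (D.ρ a)
    exact (TensorProduct.smul_tmul a D.oneR m).symm.trans (congrArg (· ⊗ₜ[D.P] m) h)
  · rintro _ _ ⟨a, rfl⟩ ⟨b, rfl⟩
    exact ⟨a + b, map_add _ _ _⟩

variable {D}

/-- The map underlying a map of `P`-modules into the restriction of a `P'`-module. -/
def vecMap (f : D ⟶ E) {M : ModuleCat.{u} D.P} {N : ModuleCat.{u} E.P} (a : M ⟶ (res f).obj N) :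
    D.toVec.obj M ⟶ E.toVec.obj N :=
  ModuleCat.ofHom (X := D.toVec.obj M) (Y := E.toVec.obj N)
    { toFun := fun m => a.hom m
      map_add' := fun x y => map_add a.hom x y
      map_smul' := fun c m => by
        refine (map_smul a.hom (algebraMap ℂ D.P c) (show M from m)).trans ?_
        change f.φ (algebraMap ℂ D.P c) • (show N from a.hom m) =
          algebraMap ℂ E.P c • (show N from a.hom m)
        rw [f.φ.commutes] }

theorem unitMap_naturality (f : D ⟶ E) {M : ModuleCat.{u} D.P} {N : ModuleCat.{u} E.P}
    (a : M ⟶ (res f).obj N) :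
    D.unitMap M ≫ D.tensorR.map a ≫ tensorMap f N = vecMap f a ≫ E.unitMap N := by
  ext m
  have h : psi f D.oneR = E.oneR := map_one f.ψ
  exact congrArg (· ⊗ₜ[E.P] (show N from a.hom m)) h

namespace Resolution

variable (r : Resolution D) (s : Resolution E) (p : ℕ)

/-- The complex `R ⊗_P K`. -/
abbrev complex : ChainComplex (ModuleCat.{u} ℂ) ℕ :=
  (D.tensorR.mapHomologicalComplex (ComplexShape.down ℕ)).obj r.K

/-- The linear relation between `K_p` and `Tor_p^P(R, ℂ)`: an element `m` of `K_p` is related to `z`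
if `1 ⊗ m` is a cycle of `R ⊗_P K` that represents `z`. -/
def rel : Submodule ℂ (D.toVec.obj (r.K.X p) × D.tor p) :=
  (LinearMap.range ((r.complex.iCycles p).hom.prod (r.complex.homologyπ p).hom)).comap
    ((D.unitMap (r.K.X p)).hom.prodMap (r.torIso p).hom.hom)

variable {r s p}

theorem mem_rel {m : D.toVec.obj (r.K.X p)} {z : D.tor p} :
    (m, z) ∈ r.rel p ↔ ∃ c, (r.complex.iCycles p).hom c = (D.unitMap (r.K.X p)).hom m ∧
      (r.complex.homologyπ p).hom c = (r.torIso p).hom.hom z := by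
  refine exists_congr fun c => ?_
  exact Prod.ext_iff

theorem eq_zero_of_mem_rel {z : D.tor p} (h : (0, z) ∈ r.rel p) : z = 0 := by
  obtain ⟨c, hc, hz⟩ := mem_rel.1 h
  rw [map_zero] at hc
  have hi : Function.Injective (r.complex.iCycles p).hom :=
    (ModuleCat.mono_iff_injective _).1 inferInstance
  have h0 : c = 0 := hi (hc.trans (map_zero _).symm)
  rw [h0, map_zero] at hz
  have hj : Function.Injective (r.torIso p).hom.hom :=
    (ModuleCat.mono_iff_injective (r.torIso p).hom).1 inferInstance
  exact hj (hz.symm.trans (map_zero _).symm)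

theorem exists_mem_rel (hρ : Function.Surjective D.ρ) (z : D.tor p) : ∃ m, (m, z) ∈ r.rel p := by
  obtain ⟨c, hc⟩ := (ModuleCat.epi_iff_surjective (r.complex.homologyπ p)).1 inferInstance
    ((r.torIso p).hom.hom z)
  obtain ⟨m, hm⟩ := D.unitMap_surjective hρ (r.K.X p) ((r.complex.iCycles p).hom c)
  exact ⟨m, mem_rel.2 ⟨c, hm.symm, hc⟩⟩

theorem map_mem_rel {f : D ⟶ E} {κ : r.K ⟶ ((res f).mapHomologicalComplex _).obj s.K}
    (hκ : κ.f 0 ≫ (res f).map s.e = r.e ≫ modCMap f)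
    {m : D.toVec.obj (r.K.X p)} {z : D.tor p} (h : (m, z) ∈ r.rel p) :
    ((vecMap f (κ.f p)).hom m, (torMap p f).hom z) ∈ s.rel p := by
  obtain ⟨c, hc, hz⟩ := mem_rel.1 h
  refine mem_rel.2 ⟨(HomologicalComplex.cyclesMap (tensorChain f κ) p).hom c, ?_, ?_⟩
  · have h1 := congrArg (fun k => k.hom c) (HomologicalComplex.cyclesMap_i (tensorChain f κ) p)
    have h2 := congrArg (fun k => k.hom m) (unitMap_naturality f (κ.f p))
    simp only [ModuleCat.hom_comp, LinearMap.comp_apply] at h1 h2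
    rw [hc] at h1
    exact h1.trans h2
  · have h1 := congrArg (fun k => k.hom c)
      (HomologicalComplex.homologyπ_naturality (tensorChain f κ) p)
    have h2 := congrArg (fun k => k.hom z) (torMap_comp_torIso r s p f κ hκ)
    simp only [ModuleCat.hom_comp, LinearMap.comp_apply] at h1 h2
    rw [h1.symm.trans (congrArg _ hz), h2]

end Resolution

end AugAlg

/-! ### Subquotients of functors from linear relations -/

/-- The subfunctor of a functor to vector spaces given by a stable family of subspaces. -/
def subfunctor {C : Type v} [Category.{w} C] (G : C ⥤ ModuleCat.{u} ℂ)
    (N : ∀ A, Submodule ℂ (G.obj A))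
    (hN : ∀ {A B} (f : A ⟶ B), ∀ x ∈ N A, (G.map f).hom x ∈ N B) : C ⥤ ModuleCat.{u} ℂ where
  obj A := ModuleCat.of ℂ (N A)
  map f := ModuleCat.ofHom ((G.map f).hom.restrict (hN f))
  map_id A := ModuleCat.hom_ext (LinearMap.ext fun x =>
    Subtype.ext (LinearMap.congr_fun (congrArg ModuleCat.Hom.hom (G.map_id A)) x.1))
  map_comp f g := ModuleCat.hom_ext (LinearMap.ext fun x =>
    Subtype.ext (LinearMap.congr_fun (congrArg ModuleCat.Hom.hom (G.map_comp f g)) x.1))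

/-- The pointwise product of two functors to vector spaces. -/
def prodFunctor {C : Type v} [Category.{w} C] (G F : C ⥤ ModuleCat.{u} ℂ) :
    C ⥤ ModuleCat.{u} ℂ where
  obj A := ModuleCat.of ℂ (G.obj A × F.obj A)
  map f := ModuleCat.ofHom ((G.map f).hom.prodMap (F.map f).hom)
  map_id A := ModuleCat.hom_ext (LinearMap.ext fun x => Prod.ext
    (LinearMap.congr_fun (congrArg ModuleCat.Hom.hom (G.map_id A)) x.1)
    (LinearMap.congr_fun (congrArg ModuleCat.Hom.hom (F.map_id A)) x.2))
  map_comp f g := ModuleCat.hom_ext (LinearMap.ext fun x => Prod.ext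
    (LinearMap.congr_fun (congrArg ModuleCat.Hom.hom (G.map_comp f g)) x.1)
    (LinearMap.congr_fun (congrArg ModuleCat.Hom.hom (F.map_comp f g)) x.2))

/-- A functor `F` is a subquotient of `G` if there is a natural linear relation between `G` and `F`
that is single-valued and hits all of `F`. -/
theorem IsSubquotient.of_rel {C : Type v} [Category.{w} C] {F G : C ⥤ ModuleCat.{u} ℂ}
    (N : ∀ A, Submodule ℂ (G.obj A × F.obj A))
    (hN : ∀ {A B} (f : A ⟶ B) (x y), (x, y) ∈ N A → ((G.map f).hom x, (F.map f).hom y) ∈ N B)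
    (single : ∀ A (y : F.obj A), (0, y) ∈ N A → y = 0)
    (total : ∀ A (y : F.obj A), ∃ x, (x, y) ∈ N A) : IsSubquotient F G := by
  let S := subfunctor (prodFunctor G F) N fun f x hx => hN f x.1 x.2 hx
  let i : S ⟶ G :=
    { app := fun A => ModuleCat.ofHom (X := S.obj A) (Y := G.obj A)
        (LinearMap.fst ℂ (G.obj A) (F.obj A) ∘ₗ Submodule.subtype (N A))
      naturality := fun _ _ _ => rfl }
  let q : S ⟶ F :=
    { app := fun A => ModuleCat.ofHom (X := S.obj A) (Y := F.obj A)
        (LinearMap.snd ℂ (G.obj A) (F.obj A) ∘ₗ Submodule.subtype (N A))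
      naturality := fun _ _ _ => rfl }
  have hi : ∀ A, Mono (i.app A) := fun A => by
    refine (ModuleCat.mono_iff_injective _).2 ((injective_iff_map_eq_zero _).2 ?_)
    rintro ⟨⟨x, y⟩, h⟩ (rfl : x = 0)
    exact Subtype.ext (Prod.ext rfl (single A y h))
  have hq : ∀ A, Epi (q.app A) := fun A => by
    refine (ModuleCat.epi_iff_surjective _).2 fun y => ?_
    obtain ⟨x, hx⟩ := total A y
    exact ⟨⟨(x, y), hx⟩, rfl⟩
  exact ⟨S, i, q, NatTrans.mono_of_mono_app i, NatTrans.epi_of_epi_app q⟩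

theorem IsSubquotient.of_iso {C : Type v} [Category.{w} C] {F G G' : C}
    (h : IsSubquotient F G) (e : G ≅ G') : IsSubquotient F G' := by
  obtain ⟨S, i, q, hi, hq⟩ := h
  exact ⟨S, i ≫ e.hom, q, mono_comp i e.hom, hq⟩

theorem IsSubquotient.of_isZero {C : Type v} [Category.{w} C] [HasZeroMorphisms C] {F : C}
    (h : IsZero F) (G : C) : IsSubquotient F G :=
  ⟨F, 0, 𝟙 F, ⟨fun _ _ _ => h.eq_of_tgt _ _⟩, inferInstance⟩

/-- Subquotients of functors to vector spaces restrict along functors. -/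
theorem IsSubquotient.precomp {C : Type v} [Category.{w} C] {D : Type*} [Category* D]
    {F G : C ⥤ ModuleCat.{u} ℂ} (h : IsSubquotient F G) (K : D ⥤ C) :
    IsSubquotient (K ⋙ F) (K ⋙ G) := by
  obtain ⟨S, i, q, hi, hq⟩ := h
  have h1 : ∀ A, Mono ((Functor.whiskerLeft K i).app A) := fun A =>
    (NatTrans.mono_iff_mono_app i).1 hi (K.obj A)
  have h2 : ∀ A, Epi ((Functor.whiskerLeft K q).app A) := fun A =>
    (NatTrans.epi_iff_epi_app q).1 hq (K.obj A)
  exact ⟨K ⋙ S, Functor.whiskerLeft K i, Functor.whiskerLeft K q,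
    NatTrans.mono_of_mono_app _, NatTrans.epi_of_epi_app _⟩

/-! ### Homogeneous pieces of subquotients -/

/-- Interpolation: some combination of the power maps `x ↦ x ^ n` for `n ≤ N` and `x = 0, …, N`
isolates the exponent `d`. -/
theorem exists_sum_mul_pow (N d : ℕ) : ∃ c : Fin (N + 1) → ℂ, ∀ n ≤ N,
    ∑ j, c j * ((j : ℕ) : ℂ) ^ n = if n = d then 1 else 0 := by
  let V : Matrix (Fin (N + 1)) (Fin (N + 1)) ℂ := Matrix.vandermonde fun j => ((j : ℕ) : ℂ)
  have hV : IsUnit V.det := by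
    refine isUnit_iff_ne_zero.2 (Matrix.det_vandermonde_ne_zero_iff.2 fun i j h => ?_)
    exact Fin.ext (by exact_mod_cast h)
  refine ⟨Matrix.vecMul (fun n : Fin (N + 1) => if (n : ℕ) = d then 1 else 0) V⁻¹, fun n hn => ?_⟩
  have h := congrFun (Matrix.vecMul_vecMul
    (fun n : Fin (N + 1) => if (n : ℕ) = d then (1 : ℂ) else 0) V⁻¹ V) ⟨n, by omega⟩
  rw [Matrix.nonsing_inv_mul V hV, Matrix.vecMul_one] at h
  exact h

namespace VecDelta

theorem W_map_scale (A : VecDelta.{u}) (x : A.L) (t : ℂ) :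
    (W.map (A.scale x t)).hom = t • LinearMap.id := by
  classical
  have : Fintype A.L := Fintype.ofFinite _
  refine LinearMap.ext fun v => ?_
  refine Eq.trans ?_ (congrArg (t • ·) (LinearMap.congr_fun (wMap_id A) v))
  have h := map_smul_family (fun y => if y = x then t else 1) (Hom.id A).lin v
  rw [Finset.prod_ite_eq' Finset.univ x fun _ => t, if_pos (Finset.mem_univ x)] at h
  exact (congrArg (flatten (totalEquiv fun z : A.L => z) fun y => A.V y) h).trans (map_smul _ _ _)

end VecDelta

theorem PhiT_map_scale (n : ℕ) (A : VecDelta.{u}) (x : A.L) (t : ℂ) (v : (PhiT n).obj A) :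
    ((PhiT n).map (A.scale x t)).hom v = t ^ n • v := by
  change PiTensorProduct.map (fun _ : Fin n => (VecDelta.W.map (A.scale x t)).hom) v = _
  rw [VecDelta.W_map_scale]
  refine (VecDelta.map_smul_family (fun _ : Fin n => t) (fun _ => LinearMap.id) v).trans ?_
  rw [PiTensorProduct.map_id, Finset.prod_const, Finset.card_univ, Fintype.card_fin]
  rfl

/-- If `F` is related by a natural linear relation, single-valued and hitting all of `F`, to a
functor `E` which is spanned by images of the `PhiT (m + p)`, one for every `m`, then the degree `d`
piece of `F` is a subquotient of `PhiT d`. -/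
theorem degreePiece_isSubquotient {F E : VecDelta.{u} ⥤ ModuleCat.{u} ℂ} {p : ℕ}
    (N : ∀ A, Submodule ℂ (E.obj A × F.obj A))
    (hN : ∀ {A B} (f : A ⟶ B) (x y), (x, y) ∈ N A → ((E.map f).hom x, (F.map f).hom y) ∈ N B)
    (single : ∀ A (y : F.obj A), (0, y) ∈ N A → y = 0)
    (total : ∀ A (y : F.obj A), ∃ x, (x, y) ∈ N A)
    (τ : ∀ m, PhiT (m + p) ⟶ E)
    (hτ : ∀ A, ⨆ m, LinearMap.range ((τ m).app A).hom = ⊤) (d : ℕ) :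
    IsSubquotient (degreePiece F d) (PhiT d) := by
  have key : ∀ A (y : (degreePiece F d).obj A), ∃ s : ℕ →₀ E.obj A,
      (∀ m, s m ∈ LinearMap.range ((τ m).app A).hom) ∧
      (∑ m ∈ s.support, if m + p = d then s m else 0, y.1) ∈ N A := by
    intro A y
    obtain ⟨e, he⟩ := total A y.1
    have hmem : e ∈ ⨆ m, LinearMap.range ((τ m).app A).hom := by rw [hτ]; trivial
    obtain ⟨s, hs, rfl⟩ := (Submodule.mem_iSup_iff_exists_finsupp _ _).1 hmem
    refine ⟨s, hs, ?_⟩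
    choose v hv using hs
    let M := max d (s.support.sup fun m => m + p)
    obtain ⟨c, hc⟩ := exists_sum_mul_pow M d
    obtain ⟨x⟩ := A.nonempty
    -- The interpolating combination of scalings fixes `y` and projects `e` to its degree `d` part.
    have hmem2 : (∑ j, c j • (E.map (A.scale x ((j : ℕ) : ℂ))).hom (s.sum fun _ a => a),
        ∑ j, c j • (F.map (A.scale x ((j : ℕ) : ℂ))).hom y.1) ∈ N A := by
      have := Submodule.sum_mem (N A) (t := Finset.univ) fun (j : Fin (M + 1)) _ =>
        Submodule.smul_mem (N A) (c j) (hN (A.scale x ((j : ℕ) : ℂ)) _ _ he)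
      convert this using 1
      exact Prod.ext (by simp [Prod.fst_sum]) (by simp [Prod.snd_sum])
    have hy : ∑ j, c j • (F.map (A.scale x ((j : ℕ) : ℂ))).hom y.1 = y.1 := by
      have h1 : ∀ t : ℂ, (F.map (A.scale x t)).hom y.1 = t ^ d • y.1 := fun t => y.2 x t
      simp only [h1, smul_smul]
      rw [← Finset.sum_smul, hc d (le_max_left _ _), if_pos rfl, one_smul]
    have hE : ∀ (m : ℕ) (t : ℂ), (E.map (A.scale x t)).hom (s m) = t ^ (m + p) • s m :=
        fun m t => by
      rw [← hv m]
      have h2 := congrArg (fun k => k.hom (v m)) ((τ m).naturality (A.scale x t))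
      simp only [ModuleCat.hom_comp, LinearMap.comp_apply] at h2
      rw [← h2, PhiT_map_scale, map_smul]
    have he' : ∑ j, c j • (E.map (A.scale x ((j : ℕ) : ℂ))).hom (s.sum fun _ a => a) =
        ∑ m ∈ s.support, if m + p = d then s m else 0 := by
      have h1 : ∀ j : Fin (M + 1), c j • (E.map (A.scale x ((j : ℕ) : ℂ))).hom (s.sum fun _ a => a) =
          ∑ m ∈ s.support, (c j * ((j : ℕ) : ℂ) ^ (m + p)) • s m := fun j => by
        rw [Finsupp.sum, map_sum, Finset.smul_sum]
        exact Finset.sum_congr rfl fun m _ => by rw [hE, smul_smul]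
      rw [Finset.sum_congr rfl fun j _ => h1 j, Finset.sum_comm]
      refine Finset.sum_congr rfl fun m hm => ?_
      have hle : m + p ≤ M := (Finset.le_sup (f := fun m => m + p) hm).trans (le_max_right _ _)
      rw [← Finset.sum_smul, hc _ hle, ite_smul, one_smul, zero_smul]
    rwa [hy, he'] at hmem2
  rcases lt_or_ge d p with hd | hd
  · refine IsSubquotient.of_rel (fun A => ⊥) ?_ ?_ ?_
    · rintro A B f x y ⟨⟩
      exact Prod.ext (map_zero _) (map_zero _)
    · rintro A y ⟨⟩
      rfl
    · intro A y
      obtain ⟨s, _, hs⟩ := key A y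
      rw [Finset.sum_eq_zero fun m _ => if_neg (by omega)] at hs
      exact ⟨0, Prod.ext rfl (Subtype.ext (single A y.1 hs))⟩
  obtain ⟨m, rfl⟩ : ∃ m, d = m + p := ⟨d - p, by omega⟩
  refine IsSubquotient.of_rel
    (fun A => (N A).comap (((τ m).app A).hom.prodMap (Submodule.subtype _))) ?_ ?_ ?_
  · intro A B f x y h
    have h1 := hN f _ _ h
    have h2 := congrArg (fun k => k.hom x) ((τ m).naturality f)
    simp only [ModuleCat.hom_comp, LinearMap.comp_apply] at h2
    change (((τ m).app B).hom (((PhiT (m + p)).map f).hom x), _) ∈ N B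
    rw [h2]
    exact h1
  · intro A y h
    refine Subtype.ext (single A y.1 ?_)
    have h1 : (((τ m).app A).hom 0, y.1) ∈ N A := h
    rwa [map_zero] at h1
  · intro A y
    obtain ⟨s, hs, hsy⟩ := key A y
    obtain ⟨v, hv⟩ := hs m
    refine ⟨v, ?_⟩
    have h : (∑ i ∈ s.support, if i + p = m + p then s i else 0) = s m := by
      simp only [Nat.add_right_cancel_iff, Finset.sum_ite_eq']
      split_ifs with hm
      · rfl
      · exact (Finsupp.notMem_support_iff.1 hm).symm
    rw [h, ← hv] at hsy
    exact hsy

/-! ### Subquotients of `PhiT d` -/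

/-- The functor `V ↦ ⨂_{(x, i)} V_x` of families indexed by `L`, with `i` running through `d`
values. -/
def flatPowers (L : Type u) (d : ℕ) : (L → ModuleCat.{u} ℂ) ⥤ ModuleCat.{u} ℂ where
  obj V := ModuleCat.of ℂ (⨂[ℂ] z : L × ULift.{u} (Fin d), V z.1)
  map g := ModuleCat.ofHom (PiTensorProduct.map fun z : L × ULift.{u} (Fin d) => (g z.1).hom)
  map_id V := by
    refine ModuleCat.hom_ext ?_
    simp
  map_comp g h := by
    refine ModuleCat.hom_ext ?_
    simp [PiTensorProduct.map_comp]

section Swap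

variable {L : Type u} [Finite L] (d : ℕ) (V : L → Type u) [∀ x, AddCommMonoid (V x)]
  [∀ x, Module ℂ (V x)]

/-- The regrouping `⨂_{(x, i)} V_x ≅ ⨂_x ⨂_i V_x`. -/
def flatEquivLeft :
    (⨂[ℂ] z : L × ULift.{u} (Fin d), V z.1) ≃ₗ[ℂ] ⨂[ℂ] x, ⨂[ℂ] _ : Fin d, V x :=
  (flatten (Equiv.sigmaEquivProd L (ULift.{u} (Fin d))) fun z => V z.1).symm ≪≫ₗ
    PiTensorProduct.congr fun x => PiTensorProduct.reindex ℂ (fun _ => V x) Equiv.ulift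

theorem flatEquivLeft_tprod (m : ∀ z : L × ULift.{u} (Fin d), V z.1) :
    flatEquivLeft d V (PiTensorProduct.tprod ℂ m) =
      PiTensorProduct.tprod ℂ fun x => PiTensorProduct.tprod ℂ fun i => m (x, ⟨i⟩) := by
  have h : (flatten (Equiv.sigmaEquivProd L (ULift.{u} (Fin d))) fun z => V z.1).symm
      (PiTensorProduct.tprod ℂ m) = PiTensorProduct.tprod ℂ fun x =>
        PiTensorProduct.tprod ℂ fun i => m (x, i) :=
    nest_tprod (Equiv.sigmaEquivProd L (ULift.{u} (Fin d))) (fun z => V z.1) m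
  refine (congrArg _ h).trans ((PiTensorProduct.congr_tprod _ _).trans ?_)
  congr 1
  funext x
  exact PiTensorProduct.reindex_tprod _ _

/-- The regrouping `⨂_{(x, i)} V_x ≅ ⨂_i ⨂_x V_x`. -/
def flatEquivRight :
    (⨂[ℂ] z : L × ULift.{u} (Fin d), V z.1) ≃ₗ[ℂ] ⨂[ℂ] _ : Fin d, ⨂[ℂ] x, V x :=
  (flatten ((Equiv.sigmaEquivProd (ULift.{u} (Fin d)) L).trans (Equiv.prodComm _ _))
    fun z => V z.1).symm ≪≫ₗ PiTensorProduct.reindex ℂ (fun _ => ⨂[ℂ] x, V x) Equiv.ulift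

theorem flatEquivRight_tprod (m : ∀ z : L × ULift.{u} (Fin d), V z.1) :
    flatEquivRight d V (PiTensorProduct.tprod ℂ m) =
      PiTensorProduct.tprod ℂ fun i => PiTensorProduct.tprod ℂ fun x => m (x, ⟨i⟩) := by
  have h : (flatten ((Equiv.sigmaEquivProd (ULift.{u} (Fin d)) L).trans (Equiv.prodComm _ _))
      fun z => V z.1).symm (PiTensorProduct.tprod ℂ m) = PiTensorProduct.tprod ℂ fun i =>
        PiTensorProduct.tprod ℂ fun x => m (x, i) :=
    nest_tprod ((Equiv.sigmaEquivProd (ULift.{u} (Fin d)) L).trans (Equiv.prodComm _ _))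
      (fun z => V z.1) m
  exact (congrArg _ h).trans (PiTensorProduct.reindex_tprod _ _)

end Swap

theorem VecDelta.W_map_family {L : Type u} [Finite L] [Nonempty L] {V V' : L → ModuleCat.{u} ℂ}
    (g : V ⟶ V') : (VecDelta.W.map ((VecDelta.family L).map g)).hom =
      PiTensorProduct.map fun x => (g x).hom := by
  refine PiTensorProduct.ext (MultilinearMap.ext fun m => ?_)
  have h : ∀ x : L, ((VecDelta.family L).map g).lin x (m x) =
      PiTensorProduct.tprod ℂ fun c : {y : L // y = x} => (g c.1).hom (m c.1) := by
    intro x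
    refine (LinearEquiv.symm_apply_eq _).2 ?_
    exact (PiTensorProduct.subsingletonEquiv_apply_tprod (R := ℂ)
      (⟨x, rfl⟩ : {y : L // y = x}) (fun c => (g c.1).hom (m c.1))).symm
  refine Eq.trans ?_ (PiTensorProduct.map_tprod (fun x => (g x).hom) m).symm
  refine Eq.trans ?_ (flatten_tprod (totalEquiv (fun x : L => x)) (fun y => V' y)
    fun x => (g x).hom (m x))
  refine congrArg (flatten (totalEquiv (fun x : L => x)) (fun y => V' y)) ?_
  exact (PiTensorProduct.map_tprod _ _).trans (congrArg _ (funext h))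

/-- On families with a fixed index set, `PhiT d` is the functor `V ↦ ⨂_x V_x^{⊗ d}`. -/
def familyPhiTIso (L : Type u) [Finite L] [Nonempty L] (d : ℕ) :
    VecDelta.family L ⋙ PhiT d ≅ tensorPowers fun _ : L => d :=
  (NatIso.ofComponents (F := flatPowers L d) (G := VecDelta.family L ⋙ PhiT d)
    (fun V => (flatEquivRight d fun x => V x).toModuleIso) (by
      intro V V' g
      refine ModuleCat.hom_ext (PiTensorProduct.ext (MultilinearMap.ext fun m => ?_))
      change flatEquivRight d (fun x => V' x) (PiTensorProduct.map
        (fun z : L × ULift.{u} (Fin d) => (g z.1).hom) (PiTensorProduct.tprod ℂ m)) =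
        PiTensorProduct.map (fun _ => (VecDelta.W.map ((VecDelta.family L).map g)).hom)
          (flatEquivRight d (fun x => V x) (PiTensorProduct.tprod ℂ m))
      rw [VecDelta.W_map_family, PiTensorProduct.map_tprod, flatEquivRight_tprod,
        flatEquivRight_tprod]
      refine Eq.trans ?_ (PiTensorProduct.map_tprod _ _).symm
      exact congrArg _ (funext fun i => (PiTensorProduct.map_tprod _ _).symm))).symm ≪≫
  NatIso.ofComponents (F := flatPowers L d) (G := tensorPowers fun _ : L => d)
    (fun V => (flatEquivLeft d fun x => V x).toModuleIso) (by
      intro V V' g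
      refine ModuleCat.hom_ext (PiTensorProduct.ext (MultilinearMap.ext fun m => ?_))
      change flatEquivLeft d (fun x => V' x) (PiTensorProduct.map
        (fun z : L × ULift.{u} (Fin d) => (g z.1).hom) (PiTensorProduct.tprod ℂ m)) =
        PiTensorProduct.map (fun x => PiTensorProduct.map fun _ : Fin d => (g x).hom)
          (flatEquivLeft d (fun x => V x) (PiTensorProduct.tprod ℂ m))
      rw [PiTensorProduct.map_tprod, flatEquivLeft_tprod, flatEquivLeft_tprod]
      refine Eq.trans ?_ (PiTensorProduct.map_tprod _ _).symm
      exact congrArg _ (funext fun i => (PiTensorProduct.map_tprod _ _).symm))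

theorem isDeltaModule_of_isSubquotient {F : VecDelta.{u} ⥤ ModuleCat.{u} ℂ} {d : ℕ}
    (h : IsSubquotient F (PhiT d)) : IsDeltaModule F := fun L _ _ =>
  ⟨PUnit, fun _ _ => d, fun _ => VecDelta.family L ⋙ F,
    fun _ => (h.precomp (VecDelta.family L)).of_iso (familyPhiTIso L d),
    ⟨(coproductUniqueIso fun _ : PUnit => VecDelta.family L ⋙ F).symm⟩⟩

theorem isSmall_of_isSubquotient {F : VecDelta.{u} ⥤ ModuleCat.{u} ℂ} {d : ℕ} (hd : 0 < d)
    (h : IsSubquotient F (PhiT d)) : IsSmall F :=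
  ⟨1, fun _ => d, fun _ => hd, h.of_iso (coproductUniqueIso fun _ : Fin 1 => PhiT d).symm⟩

theorem isSmall_of_isZero {F : VecDelta.{u} ⥤ ModuleCat.{u} ℂ} (h : IsZero F) : IsSmall F :=
  ⟨0, fun _ => 1, fun i => i.elim0, .of_isZero h _⟩

/-! ### The Koszul resolution -/

/-- The Koszul differential between consecutive pieces. -/
def pieceD (W : Type u) [AddCommGroup W] [Module ℂ W] (n : ℕ) :
    Koszul.piece ℂ W (n + 1) →ₗ[SymmetricAlgebra ℂ W] Koszul.piece ℂ W n :=
  Koszul.d.restrict fun _ hy => Koszul.d_mem_piece hy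

namespace DeltaScheme

variable (X : DeltaScheme.{u})

/-- The piece `Sym W ⊗ ⋀ⁿ W` for `W = ⨂_x V_x`, as an object of the category of modules. -/
def pieceObj (A : VecDelta.{u}) (n : ℕ) : ModuleCat.{u} (X.augAlg.obj A).P :=
  show ModuleCat.{u} (SymmetricAlgebra ℂ (VecDelta.W.obj A)) from
    ModuleCat.of _ (Koszul.piece ℂ (VecDelta.W.obj A) n)

/-- The Koszul differential, as a morphism of the category of modules. -/
def pieceHom (A : VecDelta.{u}) (n : ℕ) : X.pieceObj A (n + 1) ⟶ X.pieceObj A n :=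
  ModuleCat.ofHom (pieceD (VecDelta.W.obj A) n)

/-- The Koszul complex `⋯ → Sym W ⊗ ⋀² W → Sym W ⊗ W → Sym W` for `W = ⨂_x V_x`. -/
def koszulComplex (A : VecDelta.{u}) : ChainComplex (ModuleCat.{u} (X.augAlg.obj A).P) ℕ :=
  ChainComplex.of (X.pieceObj A) (X.pieceHom A)
    (fun _ => ModuleCat.hom_ext (LinearMap.ext fun y => Subtype.ext (Koszul.d_d y.1)))

theorem koszulComplex_d (A : VecDelta.{u}) (n : ℕ) :
    (X.koszulComplex A).d (n + 1) n = X.pieceHom A n :=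
  ChainComplex.of_d _ _ _

/-- The augmentation of the Koszul complex. -/
def koszulAug (A : VecDelta.{u}) :
    X.pieceObj A 0 ⟶ (X.augAlg.obj A).modC :=
  ModuleCat.ofHom (R := (X.augAlg.obj A).P) (X := X.pieceObj A 0) (Y := (X.augAlg.obj A).modC)
    { toFun := fun y => (ULift.up (Koszul.aug (Subtype.val
        (show Koszul.piece ℂ (VecDelta.W.obj A) 0 from y))) : ULift.{u} ℂ)
      map_add' := fun x y => congrArg ULift.up (map_add Koszul.aug x.1 y.1)
      map_smul' := fun p y => congrArg ULift.up (Koszul.aug_smul p y.1) }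

theorem isResolution_koszul (A : VecDelta.{u}) :
    IsResolution (X.koszulComplex A) (X.koszulAug A) := by
  have hz : (X.koszulComplex A).d 1 0 ≫ X.koszulAug A = 0 := by
    rw [koszulComplex_d]
    exact ModuleCat.hom_ext (LinearMap.ext fun y => congrArg ULift.up (Koszul.aug_d y.1))
  refine ⟨(ModuleCat.epi_iff_surjective _).2 ?_, hz, ?_, fun n => ?_⟩
  · rintro ⟨c⟩
    refine ⟨⟨c • 1, Submodule.smul_of_tower_mem _ _ Koszul.one_mem_piece⟩, ?_⟩
    refine congrArg ULift.up ?_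
    change Koszul.aug (c • 1) = c
    rw [map_smul, map_one, smul_eq_mul, mul_one]
  · refine (ShortComplex.moduleCat_exact_iff _).2 fun z hz => ?_
    obtain ⟨y, hy, hyz⟩ := Koszul.exact_zero z.2 (congrArg ULift.down hz)
    refine ⟨⟨y, hy⟩, ?_⟩
    refine (LinearMap.congr_fun (congrArg ModuleCat.Hom.hom (X.koszulComplex_d A 0)) _).trans ?_
    exact Subtype.ext hyz
  · refine (ShortComplex.moduleCat_exact_iff _).2 fun z hz => ?_
    have hz' : (X.pieceHom A n).hom z = 0 :=
      (congrArg (fun k => k.hom z) (X.koszulComplex_d A n)).symm.trans hz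
    obtain ⟨y, hy, hyz⟩ := Koszul.exact_succ (Subtype.property
      (show Koszul.piece ℂ (VecDelta.W.obj A) (n + 1) from z)) (congrArg Subtype.val hz')
    refine ⟨⟨y, hy⟩, ?_⟩
    refine (LinearMap.congr_fun (congrArg ModuleCat.Hom.hom (X.koszulComplex_d A (n + 1))) _).trans ?_
    exact Subtype.ext hyz

/-- The Koszul resolution of `ℂ` over `Sym (⨂_x V_x)`. -/
def koszulResolution (A : VecDelta.{u}) : AugAlg.Resolution (X.augAlg.obj A) where
  K := X.koszulComplex A
  e := X.koszulAug A
  projective n := (IsProjective.iff_projective _).1 (Koszul.projective_piece n)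
  isResolution := X.isResolution_koszul A

/-- The map of Koszul pieces induced by a morphism. -/
def koszulPieceMap {A B : VecDelta.{u}} (f : A ⟶ B) (n : ℕ) :
    X.pieceObj A n ⟶ (AugAlg.res (X.augAlg.map f)).obj (X.pieceObj B n) :=
  ModuleCat.ofHom (R := (X.augAlg.obj A).P) (X := X.pieceObj A n)
    (Y := (AugAlg.res (X.augAlg.map f)).obj (X.pieceObj B n))
    { toFun := fun y => (⟨Koszul.map (VecDelta.W.map f).hom y.1, Koszul.map_mem_piece _ y.2⟩ :
        Koszul.piece ℂ (VecDelta.W.obj B) n)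
      map_add' := fun x y => Subtype.ext (map_add _ x.1 y.1)
      map_smul' := fun p y => Subtype.ext (Koszul.map_smul' _ p y.1) }

/-- The map of Koszul complexes induced by a morphism. -/
def koszulMap {A B : VecDelta.{u}} (f : A ⟶ B) :
    (X.koszulResolution A).K ⟶ ((AugAlg.res (X.augAlg.map f)).mapHomologicalComplex _).obj
      (X.koszulResolution B).K where
  f n := X.koszulPieceMap f n
  comm' i j h := by
    obtain rfl : j + 1 = i := h
    change X.koszulPieceMap f (j + 1) ≫ (AugAlg.res (X.augAlg.map f)).map
      ((X.koszulComplex B).d (j + 1) j) =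
      (X.koszulComplex A).d (j + 1) j ≫ X.koszulPieceMap f j
    rw [koszulComplex_d, koszulComplex_d]
    refine ModuleCat.hom_ext (LinearMap.ext fun y => Subtype.ext ?_)
    exact (Koszul.map_d (VecDelta.W.map f).hom y.1).symm

theorem koszulMap_aug {A B : VecDelta.{u}} (f : A ⟶ B) :
    (X.koszulMap f).f 0 ≫ (AugAlg.res (X.augAlg.map f)).map (X.koszulResolution B).e =
      (X.koszulResolution A).e ≫ AugAlg.modCMap (X.augAlg.map f) :=
  ModuleCat.hom_ext (LinearMap.ext fun y =>
    congrArg ULift.up (Koszul.aug_map (VecDelta.W.map f).hom y.1))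

/-- The functor `(V, L) ↦ Sym W ⊗ ⋀ᵖ W` for `W = ⨂_x V_x`. -/
def koszulPiece (p : ℕ) : VecDelta.{u} ⥤ ModuleCat.{u} ℂ where
  obj A := (X.augAlg.obj A).toVec.obj ((X.koszulResolution A).K.X p)
  map f := AugAlg.vecMap (X.augAlg.map f) ((X.koszulMap f).f p)
  map_id A := by
    refine ModuleCat.hom_ext (LinearMap.ext fun y => Subtype.ext ?_)
    change Koszul.map (VecDelta.W.map (𝟙 A)).hom y.1 = y.1
    rw [VecDelta.W.map_id, ModuleCat.hom_id, Koszul.map_id]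
    rfl
  map_comp f g := by
    refine ModuleCat.hom_ext (LinearMap.ext fun y => Subtype.ext ?_)
    change Koszul.map (VecDelta.W.map (f ≫ g)).hom y.1 = _
    rw [VecDelta.W.map_comp, ModuleCat.hom_comp, Koszul.map_comp]
    rfl

/-- The natural maps `W^{⊗ (m + p)} → Sym W ⊗ ⋀ᵖ W` for `W = ⨂_x V_x`. -/
def ofPhiT (p m : ℕ) : PhiT (m + p) ⟶ X.koszulPiece p where
  app A := ModuleCat.ofHom (X := (PhiT (m + p)).obj A) (Y := (X.koszulPiece p).obj A)
    { toFun := fun t => (⟨Koszul.ofTensorPower m p t, Koszul.ofTensorPower_mem_piece m p t⟩ :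
        Koszul.piece ℂ (VecDelta.W.obj A) p)
      map_add' := fun s t => Subtype.ext (map_add (Koszul.ofTensorPower m p) s t)
      map_smul' := fun c t => Subtype.ext ((map_smul (Koszul.ofTensorPower m p) c t).trans
        (algebraMap_smul (SymmetricAlgebra ℂ (VecDelta.W.obj A)) c
          (Koszul.ofTensorPower m p t)).symm) }
  naturality A B f := by
    refine ModuleCat.hom_ext (LinearMap.ext fun t => Subtype.ext ?_)
    exact Koszul.ofTensorPower_map (VecDelta.W.map f).hom m p t

theorem iSup_range_ofPhiT (p : ℕ) (A : VecDelta.{u}) :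
    ⨆ m, LinearMap.range ((X.ofPhiT p m).app A).hom = ⊤ := by
  refine eq_top_iff.2 fun y _ => ?_
  have hy : (y : Koszul.piece ℂ (VecDelta.W.obj A) p).1 ∈ _ :=
    Koszul.mem_iSup_range_ofTensorPower p (Subtype.property _)
  obtain ⟨s, hs, hsy⟩ := (Submodule.mem_iSup_iff_exists_finsupp _ _).1 hy
  choose v hv using hs
  have : y = ∑ m ∈ s.support, ((X.ofPhiT p m).app A).hom (v m) := by
    refine Subtype.ext (hsy.symm.trans ?_)
    refine Eq.trans ?_ (map_sum (Koszul.piece ℂ (VecDelta.W.obj A) p).subtype _ _).symm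
    exact Finset.sum_congr rfl fun m _ => (hv m).symm
  rw [this]
  exact Submodule.sum_mem _ fun m _ => Submodule.mem_iSup_of_mem m ⟨v m, rfl⟩

/-- Every regular function on `X(V, L)` is the restriction of a polynomial. -/
theorem ρ_surjective (A : VecDelta.{u}) : Function.Surjective (X.augAlg.obj A).ρ := by
  have := X.isClosedImmersion (Opposite.op A)
  have : IsAffine (affineSpace.obj (Opposite.op A)) :=
    inferInstanceAs (IsAffine (Spec (poly.obj A)))
  have h1 := (IsClosedImmersion.isAffine_surjective_of_isAffine (X.i.app (Opposite.op A))).2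
  have h2 : Function.Surjective (Scheme.ΓSpecIso (poly.obj A)).inv.hom :=
    (ConcreteCategory.bijective_of_isIso (Scheme.ΓSpecIso (poly.obj A)).inv).2
  exact h1.comp h2

theorem nontrivial_R (A : VecDelta.{u}) : Nontrivial (X.augAlg.obj A).R := by
  have := X.nonempty (Opposite.op A)
  have : Nonempty (⊤ : (X.X.obj (Opposite.op A)).Opens) :=
    (X.nonempty (Opposite.op A)).map fun x => ⟨x, trivial⟩
  exact inferInstanceAs (Nontrivial Γ(X.X.obj (Opposite.op A), ⊤))

/-- Every homogeneous piece of a syzygy functor is a subquotient of a single tensor power. -/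
theorem degreePiece_syzygy_isSubquotient (p d : ℕ) :
    IsSubquotient (degreePiece (X.syzygy p) d) (PhiT d) :=
  degreePiece_isSubquotient (F := X.syzygy p) (E := X.koszulPiece p)
    (fun A => (X.koszulResolution A).rel p)
    (fun f _ _ h => AugAlg.Resolution.map_mem_rel (X.koszulMap_aug f) h)
    (fun _ _ h => AugAlg.Resolution.eq_zero_of_mem_rel h)
    (fun A y => AugAlg.Resolution.exists_mem_rel (X.ρ_surjective A) y)
    (X.ofPhiT p) (X.iSup_range_ofPhiT p) d

end DeltaScheme

/-! ### The degree zero piece -/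

/-- The augmented algebra `ℂ → ℂ`. -/
def pointAug : AugAlg.{u} where
  P := ULift.{u} ℂ
  aug := ULift.algEquiv.toAlgHom
  R := ULift.{u} ℂ
  ρ := RingHom.id _

/-- The augmentation module of `pointAug` is the ring itself. -/
def pointEquiv : pointAug.{u}.P ≃ₗ[pointAug.{u}.P] pointAug.{u}.modC where
  toFun z := z
  invFun z := z
  map_add' _ _ := rfl
  map_smul' _ _ := rfl
  left_inv _ := rfl
  right_inv _ := rfl

theorem AugAlg.isZero_tor_succ (D : AugAlg.{u}) [Projective D.modC] (p : ℕ) :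
    IsZero (D.tor (p + 1)) :=
  D.toVec.map_isZero (isZero_Tor_succ_of_projective _ D.modR D.modC p)

theorem isZero_tor_pointAug (p : ℕ) : IsZero (pointAug.{u}.tor (p + 1)) :=
  have : Projective pointAug.{u}.modC :=
    ModuleCat.projective_of_free ((Module.Basis.singleton Unit pointAug.{u}.P).map pointEquiv.{u})
  AugAlg.isZero_tor_succ _ p

namespace DeltaScheme

variable (X : DeltaScheme.{u})

/-- The structure map `ℂ → P(V, L)`, as a morphism of augmented algebras. -/
def fromPoint (A : VecDelta.{u}) : pointAug ⟶ X.augAlg.obj A where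
  φ := (Algebra.ofId ℂ (X.augAlg.obj A).P).comp ULift.algEquiv.toAlgHom
  ψ := (X.augAlg.obj A).ρ.comp
    ((Algebra.ofId ℂ (X.augAlg.obj A).P).comp ULift.algEquiv.toAlgHom).toRingHom
  aug_comp := AlgHom.ext fun z => AlgHom.commutes (X.augAlg.obj A).aug z.down
  comm := rfl

theorem fromPoint_comp {A B : VecDelta.{u}} (f : A ⟶ B) :
    X.fromPoint A ≫ X.augAlg.map f = X.fromPoint B := by
  have h : ∀ z : ULift.{u} ℂ, (X.augAlg.map f).φ (algebraMap ℂ (X.augAlg.obj A).P z.down) =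
      algebraMap ℂ (X.augAlg.obj B).P z.down := fun z => (X.augAlg.map f).φ.commutes z.down
  refine AugAlg.Hom.ext (AlgHom.ext h) (RingHom.ext fun z => ?_)
  refine (RingHom.congr_fun (X.augAlg.map f).comm (algebraMap ℂ (X.augAlg.obj A).P z.down)).trans ?_
  exact congrArg (X.augAlg.obj B).ρ (h z)

theorem augAlg_map_scale_zero_φ (A : VecDelta.{u}) (x : A.L) (a : (X.augAlg.obj A).P) :
    (X.augAlg.map (A.scale x 0)).φ a =
      algebraMap ℂ (X.augAlg.obj A).P ((X.augAlg.obj A).aug a) := by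
  have h : polyMap (A.scale x 0) = (Algebra.ofId ℂ _).comp SymmetricAlgebra.algebraMapInv := by
    refine SymmetricAlgebra.algHom_ext (LinearMap.ext fun w => ?_)
    have h1 : polyMap (A.scale x 0) (SymmetricAlgebra.ι ℂ _ w) =
        SymmetricAlgebra.ι ℂ _ ((VecDelta.W.map (A.scale x 0)).hom w) :=
      SymmetricAlgebra.lift_ι_apply _ _
    have h2 : (SymmetricAlgebra.algebraMapInv (SymmetricAlgebra.ι ℂ (VecDelta.W.obj A) w) : ℂ) = 0 :=
      SymmetricAlgebra.algebraMapInv_ι w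
    refine h1.trans (Eq.trans ?_ (congrArg (algebraMap ℂ (SymmetricAlgebra ℂ (VecDelta.W.obj A)))
      h2).symm)
    rw [VecDelta.W_map_scale, zero_smul, LinearMap.zero_apply, map_zero, map_zero]
  exact DFunLike.congr_fun h a

/-- The scheme `X(V, L)` contains the origin: it is not empty and stable under scaling by `0`. -/
theorem ker_ρ_le_ker_aug (A : VecDelta.{u}) :
    RingHom.ker (X.augAlg.obj A).ρ ≤ RingHom.ker (X.augAlg.obj A).aug.toRingHom := by
  intro a ha
  obtain ⟨x⟩ := A.nonempty
  have := X.nontrivial_R A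
  by_contra hne
  have hne' : (X.augAlg.obj A).aug a ≠ 0 := hne
  have h1 := RingHom.congr_fun (X.augAlg.map (A.scale x 0)).comm a
  have h2 : (X.augAlg.obj A).ρ ((X.augAlg.map (A.scale x 0)).φ a) = 0 :=
    h1.symm.trans ((congrArg (X.augAlg.map (A.scale x 0)).ψ ha).trans
      (map_zero (X.augAlg.map (A.scale x 0)).ψ))
  rw [augAlg_map_scale_zero_φ] at h2
  have h3 : IsUnit ((X.augAlg.obj A).ρ (algebraMap ℂ _ ((X.augAlg.obj A).aug a))) :=
    ((isUnit_iff_ne_zero.2 hne').map (algebraMap ℂ (X.augAlg.obj A).P)).map _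
  rw [h2] at h3
  exact not_isUnit_zero h3

/-- Evaluation at the origin, as a morphism of augmented algebras. -/
def toPoint (A : VecDelta.{u}) : X.augAlg.obj A ⟶ pointAug where
  φ := ULift.algEquiv.symm.toAlgHom.comp (X.augAlg.obj A).aug
  ψ := RingHom.liftOfSurjective (X.augAlg.obj A).ρ (X.ρ_surjective A)
    ⟨(ULift.algEquiv.symm.toAlgHom.comp (X.augAlg.obj A).aug).toRingHom, fun _ ha =>
      congrArg ULift.up (X.ker_ρ_le_ker_aug A ha)⟩
  aug_comp := rfl
  comm := RingHom.liftOfSurjective_comp _ _ _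

theorem toPoint_ψ (A : VecDelta.{u}) (a : (X.augAlg.obj A).P) :
    (X.toPoint A).ψ ((X.augAlg.obj A).ρ a) = ULift.up ((X.augAlg.obj A).aug a) :=
  RingHom.congr_fun (X.toPoint A).comm a

theorem fromPoint_toPoint (A : VecDelta.{u}) : X.fromPoint A ≫ X.toPoint A = 𝟙 _ := by
  have h : ∀ z : ULift.{u} ℂ,
      ULift.up ((X.augAlg.obj A).aug (algebraMap ℂ (X.augAlg.obj A).P z.down)) = z :=
    fun z => congrArg ULift.up ((X.augAlg.obj A).aug.commutes z.down)
  exact AugAlg.Hom.ext (AlgHom.ext h) (RingHom.ext fun z => (X.toPoint_ψ A _).trans (h z))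

theorem toPoint_fromPoint (A : VecDelta.{u}) (x : A.L) :
    X.toPoint A ≫ X.fromPoint A = X.augAlg.map (A.scale x 0) := by
  refine AugAlg.Hom.ext (AlgHom.ext fun a => (X.augAlg_map_scale_zero_φ A x a).symm)
    (RingHom.ext fun b => ?_)
  obtain ⟨a, rfl⟩ := X.ρ_surjective A b
  refine (congrArg (X.fromPoint A).ψ (X.toPoint_ψ A a)).trans ?_
  refine Eq.trans ?_ (RingHom.congr_fun (X.augAlg.map (A.scale x 0)).comm a).symm
  exact congrArg (X.augAlg.obj A).ρ (X.augAlg_map_scale_zero_φ A x a).symm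

/-- The degree zero piece of `Tor_p^P(R, ℂ)` is `Tor_p^ℂ(ℂ, ℂ)`: scaling by `0` factors through the
origin. -/
def degreeZeroEquiv (p : ℕ) (A : VecDelta.{u}) :
    pointAug.tor p ≃ₗ[ℂ] (degreePiece (X.syzygy p) 0).obj A where
  toFun z := ⟨(AugAlg.torMap p (X.fromPoint A)).hom z, fun x t =>
    (LinearMap.congr_fun (congrArg ModuleCat.Hom.hom
      ((AugAlg.torMap_comp p (X.fromPoint A) (X.augAlg.map (A.scale x t))).symm.trans
        (congrArg (AugAlg.torMap p) (X.fromPoint_comp (A.scale x t))))) z).trans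
      ((congrArg (· • _) (pow_zero t)).trans (one_smul ℂ _)).symm⟩
  map_add' x y := Subtype.ext (map_add _ x y)
  map_smul' c x := Subtype.ext (map_smul _ c x)
  invFun y := (AugAlg.torMap p (X.toPoint A)).hom y.1
  left_inv z := LinearMap.congr_fun (congrArg ModuleCat.Hom.hom
    ((AugAlg.torMap_comp p (X.fromPoint A) (X.toPoint A)).symm.trans
      ((congrArg (AugAlg.torMap p) (X.fromPoint_toPoint A)).trans (AugAlg.torMap_id p _)))) z
  right_inv y := by
    obtain ⟨x⟩ := A.nonempty
    refine Subtype.ext ?_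
    refine (LinearMap.congr_fun (congrArg ModuleCat.Hom.hom
      ((AugAlg.torMap_comp p (X.toPoint A) (X.fromPoint A)).symm.trans
        (congrArg (AugAlg.torMap p) (X.toPoint_fromPoint A x)))) y.1).trans ?_
    exact (y.2 x 0).trans ((congrArg (· • y.1) (pow_zero (0 : ℂ))).trans (one_smul ℂ _))

/-- The degree zero piece of a syzygy functor is constant. -/
def degreeZeroIso (p : ℕ) :
    (Functor.const VecDelta.{u}).obj (pointAug.tor p) ≅ degreePiece (X.syzygy p) 0 :=
  NatIso.ofComponents (fun A => (X.degreeZeroEquiv p A).toModuleIso) (by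
    intro A B f
    refine ModuleCat.hom_ext (LinearMap.ext fun z => Subtype.ext ?_)
    change (AugAlg.torMap p (X.fromPoint B)).hom z =
      (AugAlg.torMap p (X.augAlg.map f)).hom ((AugAlg.torMap p (X.fromPoint A)).hom z)
    rw [← LinearMap.comp_apply, ← ModuleCat.hom_comp, ← AugAlg.torMap_comp, fromPoint_comp])

end DeltaScheme

/-- `Tor_0^ℂ(ℂ, ℂ) = ℂ`. -/
def torZeroPointIso : pointAug.{u}.tor 0 ≅ ModuleCat.of ℂ (ULift.{u} ℂ) :=
  pointAug.toVec.mapIso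
    (((((MonoidalCategory.tensoringLeft _).obj pointAug.{u}.modR).leftDerivedZeroIsoSelf).app
      pointAug.modC) ≪≫
    (TensorProduct.lid pointAug.{u}.P pointAug.{u}.modC).toModuleIso) ≪≫
  { hom := ModuleCat.ofHom (R := ℂ) (X := pointAug.{u}.toVec.obj pointAug.{u}.modC)
      (Y := ULift.{u} ℂ)
      { toFun := fun z => z
        map_add' := fun _ _ => rfl
        map_smul' := fun _ _ => rfl }
    inv := ModuleCat.ofHom (R := ℂ) (X := ULift.{u} ℂ)
      (Y := pointAug.{u}.toVec.obj pointAug.{u}.modC)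
      { toFun := fun z => z
        map_add' := fun _ _ => rfl
        map_smul' := fun _ _ => rfl } }

/-- The functor `PhiT 0` is constant with value `ℂ`. -/
def phiTZeroIso :
    PhiT.{u} 0 ≅ (Functor.const VecDelta.{u}).obj (ModuleCat.of ℂ (ULift.{u} ℂ)) :=
  NatIso.ofComponents
    (fun A => LinearEquiv.toModuleIso
      (PiTensorProduct.isEmptyEquiv (R := ℂ) (s := fun _ : Fin 0 => VecDelta.W.obj A) (Fin 0) ≪≫ₗ
        ULift.moduleEquiv.symm)) (by
    intro A B f
    refine ModuleCat.hom_ext (PiTensorProduct.ext (MultilinearMap.ext fun m => ?_))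
    refine congrArg ULift.up ?_
    change PiTensorProduct.isEmptyEquiv (Fin 0) (PiTensorProduct.map
      (fun _ : Fin 0 => (VecDelta.W.map f).hom) (PiTensorProduct.tprod ℂ m)) =
      PiTensorProduct.isEmptyEquiv (Fin 0) (PiTensorProduct.tprod ℂ m)
    rw [PiTensorProduct.map_tprod, PiTensorProduct.isEmptyEquiv_apply_tprod,
      PiTensorProduct.isEmptyEquiv_apply_tprod])

end DeltaSyz

end

theorem mainTheorem11 (X : DeltaSyz.DeltaScheme.{u}) (p d : ℕ) :
    DeltaSyz.IsDeltaModule (DeltaSyz.degreePiece (X.syzygy p) d) ∧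
    (p ≠ 0 ∨ d ≠ 0 → DeltaSyz.IsSmall (DeltaSyz.degreePiece (X.syzygy p) d)) ∧
    (p = 0 ∧ d = 0 →
      Nonempty (DeltaSyz.degreePiece (X.syzygy p) d ≅ DeltaSyz.PhiT.{u} 0)) := by
  have h := X.degreePiece_syzygy_isSubquotient p d
  refine ⟨DeltaSyz.isDeltaModule_of_isSubquotient h, fun hpd => ?_, ?_⟩
  · rcases Nat.eq_zero_or_pos d with rfl | hd
    · obtain ⟨q, rfl⟩ := Nat.exists_eq_succ_of_ne_zero (hpd.resolve_right (· rfl))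
      refine DeltaSyz.isSmall_of_isZero (IsZero.of_iso ?_ (X.degreeZeroIso (q + 1)).symm)
      exact Functor.isZero _ fun _ => DeltaSyz.isZero_tor_pointAug q
    · exact DeltaSyz.isSmall_of_isSubquotient hd h
  · rintro ⟨rfl, rfl⟩
    exact ⟨(X.degreeZeroIso 0).symm ≪≫
      (Functor.const _).mapIso DeltaSyz.torZeroPointIso ≪≫ DeltaSyz.phiTZeroIso.symm⟩
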